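/- **Setting.** Let $n\ge 2$, $l\ge 1$. All derivatives below are real derivatives on $\mathbb C^n=\mathbb R^{2n}$; $|\cdot|_2$ is the Hermitian norm, $\mathrm{mes}_{2n}$ is Lebesgue measure, and distances and diameters are taken for $|\cdot|_2$. For a $C^p$ map $f$ with values in $\mathbb R$ or $\mathbb C^l$ put $$\|D^kf(y)\|=\sup_{|a|_2=1}|D^kf(y)(a,\dots,a)|_2,\quad \|f(y)\|_p=\max_{0\le k\le p}\|D^kf(y)\|,\quad \|f\|_{\mathcal B,p}=\sup_{y\in\mathcal B}\|f(y)\|_p .$$ For $c\in\mathbb C^l$ put $(c,f)=\sum_j c_jf_j$, and let $\mathbb S^l=\{c\in\mathbb C^l : |c|_2=1\}$. *Nondegeneracy.* Let $\mathcal U\subset\mathbb C^n$ be a connected open neighbourhood of $0$. A holomorphic map $f:\mathcal U\to\mathbb C^l$ is nondegenerate if, for every $c\ne 0$, $(c,f)$ does not vanish identically on $\mathcal U$. For a nonempty compact set $\mathcal K\subset\mathcal U$ put $\beta(\mu)=\min_{y\in\mathcal K,\,c\in\mathbb S^l}\big\|\,|(c,f)|^2(y)\big\|_\mu$. The index of nondegeneracy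 $\mu_0$ of $f$ with respect to $\mathcal K$ is the smallest positive integer $\mu$ with $\beta(\mu)>0$, and $\beta:=\beta(\mu_0)$. *Weights.* Let $\mathfrak g$ be a commutative complex Lie algebra with basis $g_1,\dots,g_l$ and let $S(x)=\sum_{i=1}^n\lambda_i(x)\,x_i\,\partial/\partial x_i$ ($x\in\mathfrak g$) be an injective Lie morphism from $\mathfrak g$ to the diagonal linear vector fields of $\mathbb C^n$. Let $\mathcal W^{k,m}_{n,*}$ be the set of nonzero linear forms $\sum_jq_j\lambda_j-\lambda_i$ on $\mathfrak g$ with $1\le i\le n$, $Q\in\mathbb N^n$ and $k\le|Q|=q_1+\dots+q_n\le m$. For $k\ge1$ put $$\omega_k(S)=\min\Big\{\max_j|\alpha(g_j)| : \alpha\in\mathcal W_{n,*}^{2^{k-1}+1,2^k}\Big\}.$$ *Diophantine conditions.* A diophantine sequence is a nonincreasing sequence $\omega=(\omega_k)_{k\ge1}$ in $]0,1]$ with $\sum_k -2^{-k}\ln\omega_k<\infty$. Put $a_k=(\omega_k/\omega_k(S))^{2/\mu_0}$. $S$ is strictly diophantine relatively to $(\omega,\mu_0)$ if $\omega$ is a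 diophantine sequence and $\lim_{k\to\infty}(2^k+n+1)^{n+1}a_k=0$. Put then $$M_{\omega,\omega(S),2/\mu_0}=\sup_{k\ge1}(2^k+n+1)^{n+1}a_k,\qquad M_{\omega,\omega(S)}=\sup_{k\ge1}\frac{\omega_k}{\omega_k(S)} .$$ **Proposition.** Let $f:\mathcal U\to\mathbb C^l$ be a nondegenerate holomorphic map on a connected open neighbourhood $\mathcal U$ of $0$ in $\mathbb C^n$, let $\mathcal K\subset\mathcal U$ be a nonempty compact set, let $\mu_0,\beta$ be as above, and assume that $S$ is strictly diophantine relatively to $(\omega,\mu_0)$. Let $0<\vartheta<\mathrm{dist}(\mathcal K,\mathbb C^n\setminus\mathcal U)$ (any $\vartheta>0$ if $\mathcal U=\mathbb C^n$), and let $\mathcal K_\vartheta$ be the open $\vartheta$-neighbourhood of $\mathcal K$. Let $\tilde f\in C^{\mu_0}(\mathcal K_\vartheta,\mathbb C^l)$ satisfy $$\|f-\tilde f\|_{\mathcal K_\vartheta,\mu_0}\le\frac{-\|f\|_{\mathcal K_\vartheta,\mu_0}+\sqrt{\|f\|_{\mathcal K_\vartheta,\mu_0}^2+\beta/2^{\mu_0-1}}}{2}.$$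 Let $0<\epsilon^*<\mathrm{mes}_{2n}\mathcal K$ and $0<\gamma\le\gamma^*$, where $$\gamma^*=\min\left[\left(\frac{\epsilon^*(n-1)!}{M\left((2^2+n)^na_2-(n+1)a_1+\frac n4M_{\omega,\omega(S),2/\mu_0}\right)}\right)^{\mu_0/2},\ \frac1{M_{\omega,\omega(S)}}\sqrt{\frac{\beta}{2\mu_0+2}}\right],$$ $$M=B\,d^{2n-1}\left(\frac1{\sqrt{2n}}+2d+\frac d\vartheta\right)\beta^{-\frac1{\mu_0}-1}\sup_{c\in\mathbb S^l}\big\|\,|(c,f)|^2\big\|_{\mathcal K_\vartheta,\mu_0+1},\qquad B=\frac{3(2\pi e)^n(\mu_0+1)^{\mu_0+2}}{(\mu_0+1)!},$$ and $d$ is the diameter of $\mathcal K$. Then the set $$\mathcal H(\tilde f)=\Big\{b\in\mathcal K : \forall i\ge1,\ \forall\alpha\in\mathcal W_{n,*}^{2^{i-1}+1,2^i},\ \Big|\alpha\Big(\sum_{j=1}^l\tilde f_j(b)g_j\Big)\Big|\ge\gamma\,\omega_i\Big\}$$ satisfies $\mathrm{mes}_{2n}\mathcal H(\tilde f)\ge\mathrm{mes}_{2n}\mathcal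 K-\epsilon^*$. -/

import Mathlib

open MeasureTheory Filter Topology
open scoped ENNReal

attribute [local instance 100] LieRing.ofAssociativeRing

noncomputable section

/-- `ℂ^m` with the norm `|x|₂ = (|x₁|² + ⋯ + |x_m|²)^{1/2}`. As a real vector space it is `ℝ^{2m}`,
with the same norm, and its `volume` is the `2m`-dimensional Lebesgue measure. -/
abbrev CSpace (m : ℕ) : Type := EuclideanSpace ℂ (Fin m)

/-! ### Norms of `C^p` maps (all derivatives are over the reals) -/

section CkNorms

variable {E F : Type*} [NormedAddCommGroup E] [NormedSpace ℝ E]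
  [NormedAddCommGroup F] [NormedSpace ℝ F]

/-- `‖f(y)‖_p = max_{0 ≤ k ≤ p} sup_{|a| = 1} |D^k f(y)(a, …, a)|`. -/
def ckNormAt (p : ℕ) (f : E → F) (y : E) : ℝ≥0∞ :=
  ⨆ k : ℕ, ⨆ _ : k ≤ p, ⨆ a : E, ⨆ _ : ‖a‖ = 1, ‖iteratedFDeriv ℝ k f y (fun _ => a)‖ₑ

/-- `‖f‖_{B,p} = sup_{y ∈ B} ‖f(y)‖_p`, with value `∞` if the derivatives are unbounded on `B`. -/
def ckNormOn (B : Set E) (p : ℕ) (f : E → F) : ℝ≥0∞ :=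
  ⨆ y : E, ⨆ _ : y ∈ B, ckNormAt p f y

end CkNorms

/-! ### Nondegenerate maps, index and amount of nondegeneracy -/

section Nondegeneracy

variable {n l : ℕ}

/-- `|(c, f(y))|²`, where `(c, f) = ∑ j, c_j f_j`. -/
def pairSq (c : CSpace l) (f : CSpace n → CSpace l) (y : CSpace n) : ℝ :=
  ‖∑ j, c j * f y j‖ ^ 2

/-- For every `c ≠ 0`, the function `∑ j, c_j f_j` does not vanish identically on `U`. -/
def IsNondegenerateOn (U : Set (CSpace n)) (f : CSpace n → CSpace l) : Prop :=
  ∀ c : CSpace l, c ≠ 0 → ∃ y ∈ U, ∑ j, c j * f y j ≠ 0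

/-- `β(μ, f, K) = min_{y ∈ K, |c| = 1} max_{0 ≤ k ≤ μ} ‖D^k |(c,f)|²(y)‖`. -/
def nondegBeta (μ : ℕ) (f : CSpace n → CSpace l) (K : Set (CSpace n)) : ℝ≥0∞ :=
  ⨅ y : CSpace n, ⨅ _ : y ∈ K, ⨅ c : CSpace l, ⨅ _ : ‖c‖ = 1, ckNormAt μ (pairSq c f) y

/-- The index of nondegeneracy of `f` with respect to `K`: the smallest positive integer `N` with
`β(N, f, K) > 0`. -/
def nondegIndex (f : CSpace n → CSpace l) (K : Set (CSpace n)) : ℕ :=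
  sInf {N : ℕ | 0 < N ∧ 0 < nondegBeta N f K}

/-- The amount of nondegeneracy of `f` with respect to `K`. -/
def nondegAmount (f : CSpace n → CSpace l) (K : Set (CSpace n)) : ℝ :=
  (nondegBeta (nondegIndex f K) f K).toReal

end Nondegeneracy

/-! ### Weights of a diagonal morphism

A linear vector field `∑ i j, A i j x_j ∂/∂x_i` on `ℂ^n` is given by its matrix `A`. A morphism `S`
from a commutative Lie algebra is diagonal if all the matrices `S x` are diagonal; then
`S x = ∑ i, λ_i(x) x_i ∂/∂x_i` where `λ_i(x)` is the `i`-th diagonal entry. -/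

section Weights

variable {n l : ℕ} {𝔤 : Type*} [LieRing 𝔤] [LieAlgebra ℂ 𝔤]

/-- The linear form `λ_i` on `𝔤`. -/
def eigenForm (S : 𝔤 →ₗ⁅ℂ⁆ Matrix (Fin n) (Fin n) ℂ) (i : Fin n) : Module.Dual ℂ 𝔤 where
  toFun x := S x i i
  map_add' x y := by simp
  map_smul' r x := by simp

/-- The weight `α_{Q,i} = ∑ j, q_j λ_j - λ_i`. -/
def weightForm (S : 𝔤 →ₗ⁅ℂ⁆ Matrix (Fin n) (Fin n) ℂ) (Q : Fin n → ℕ) (i : Fin n) :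
    Module.Dual ℂ 𝔤 :=
  ∑ j, Q j • eigenForm S j - eigenForm S i

/-- The set of nonzero weights `α_{Q,i}` of `S` with `k ≤ |Q| ≤ m`. -/
def nonzeroWeights (S : 𝔤 →ₗ⁅ℂ⁆ Matrix (Fin n) (Fin n) ℂ) (k m : ℕ) : Set (Module.Dual ℂ 𝔤) :=
  {α | α ≠ 0 ∧ ∃ (Q : Fin n → ℕ) (i : Fin n), k ≤ ∑ j, Q j ∧ ∑ j, Q j ≤ m ∧ α = weightForm S Q i}

/-- The norm `max_j |α(g_j)|` on the dual of `𝔤`. -/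
def dualMaxNorm (g : Module.Basis (Fin l) ℂ 𝔤) (α : Module.Dual ℂ 𝔤) : ℝ :=
  ⨆ j, ‖α (g j)‖

/-- `ω_k(S)`, for `k ≥ 1`: the smallest norm of the nonzero weights of degree in
`[2^(k-1) + 1, 2^k]`. -/
def omegaS (g : Module.Basis (Fin l) ℂ 𝔤) (S : 𝔤 →ₗ⁅ℂ⁆ Matrix (Fin n) (Fin n) ℂ) (k : ℕ) : ℝ :=
  sInf (dualMaxNorm g '' nonzeroWeights S (2 ^ (k - 1) + 1) (2 ^ k))

end Weights

/-! ### Diophantine sequences -/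

/-- A sequence `(ω_k)_{k ≥ 1}` in `]0, 1]`, nonincreasing, with `∑ -ln ω_k / 2^k < ∞`.
The value `ω 0` plays no role. -/
structure IsDiophantineSeq (ω : ℕ → ℝ) : Prop where
  pos : ∀ k, 1 ≤ k → 0 < ω k
  le_one : ∀ k, 1 ≤ k → ω k ≤ 1
  antitone : ∀ k, 1 ≤ k → ω (k + 1) ≤ ω k
  summable : Summable fun k : ℕ => -Real.log (ω (k + 1)) / 2 ^ (k + 1)

section StrictlyDiophantine

variable {n l : ℕ} {𝔤 : Type*} [LieRing 𝔤] [LieAlgebra ℂ 𝔤]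

/-- `a_k = (ω_k / ω_k(S))^{2/μ₀}`. -/
def ratioPow (g : Module.Basis (Fin l) ℂ 𝔤) (S : 𝔤 →ₗ⁅ℂ⁆ Matrix (Fin n) (Fin n) ℂ)
    (ω : ℕ → ℝ) (μ₀ k : ℕ) : ℝ :=
  (ω k / omegaS g S k) ^ (2 / (μ₀ : ℝ))

/-- `S` is strictly diophantine relatively to `(ω, μ₀)`. -/
structure IsStrictlyDiophantine (g : Module.Basis (Fin l) ℂ 𝔤)
    (S : 𝔤 →ₗ⁅ℂ⁆ Matrix (Fin n) (Fin n) ℂ) (ω : ℕ → ℝ) (μ₀ : ℕ) : Prop where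
  diophantine : IsDiophantineSeq ω
  tendsto_zero :
    Tendsto (fun k : ℕ => ((2 : ℝ) ^ k + n + 1) ^ (n + 1) * ratioPow g S ω μ₀ k) atTop (𝓝 0)

/-- `M_{ω,ω(S),2/μ₀} = sup_{k ≥ 1} (2^k + n + 1)^{n+1} (ω_k / ω_k(S))^{2/μ₀}`. -/
def supWeightedRatio (g : Module.Basis (Fin l) ℂ 𝔤) (S : 𝔤 →ₗ⁅ℂ⁆ Matrix (Fin n) (Fin n) ℂ)
    (ω : ℕ → ℝ) (μ₀ : ℕ) : ℝ :=
  ⨆ k : {k : ℕ // 1 ≤ k}, ((2 : ℝ) ^ (k : ℕ) + n + 1) ^ (n + 1) * ratioPow g S ω μ₀ k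

/-- `M_{ω,ω(S)} = sup_{k ≥ 1} ω_k / ω_k(S)`. -/
def supRatio (g : Module.Basis (Fin l) ℂ 𝔤) (S : 𝔤 →ₗ⁅ℂ⁆ Matrix (Fin n) (Fin n) ℂ)
    (ω : ℕ → ℝ) : ℝ :=
  ⨆ k : {k : ℕ // 1 ≤ k}, ω k / omegaS g S k

end StrictlyDiophantine

/-! ### The constants -/

section Constants

variable {n l : ℕ}

/-- `B = 3 (2πe)^n (μ₀+1)^{μ₀+2} / (μ₀+1)!`. -/
def constB (n μ₀ : ℕ) : ℝ :=
  3 * (2 * Real.pi * Real.exp 1) ^ n * ((μ₀ : ℝ) + 1) ^ (μ₀ + 2) / ((μ₀ + 1).factorial : ℝ)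

/-- `M = B d^{2n-1} (1/√(2n) + 2d + d/ϑ) β^{-1/μ₀-1} sup_{|c|=1} ‖|(f,c)|²‖_{K_ϑ,μ₀+1}`, where `d` is
the diameter of `K`, and `μ₀`, `β` are the index and the amount of nondegeneracy. -/
def constM (f : CSpace n → CSpace l) (K : Set (CSpace n)) (ϑ : ℝ) : ℝ :=
  constB n (nondegIndex f K) * Metric.diam K ^ (2 * n - 1) *
    (1 / √(2 * (n : ℝ)) + 2 * Metric.diam K + Metric.diam K / ϑ) *
    nondegAmount f K ^ (-1 / (nondegIndex f K : ℝ) - 1) *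
    (⨆ c : CSpace l, ⨆ _ : ‖c‖ = 1,
      ckNormOn (Metric.thickening ϑ K) (nondegIndex f K + 1) (pairSq c f)).toReal

/-- `(-‖f‖ + (‖f‖² + β / 2^{μ₀-1})^{1/2}) / 2`, where `‖f‖ = ‖f‖_{K_ϑ,μ₀}`. -/
def closenessBound (f : CSpace n → CSpace l) (K : Set (CSpace n)) (ϑ : ℝ) : ℝ :=
  (-(ckNormOn (Metric.thickening ϑ K) (nondegIndex f K) f).toReal +
    √((ckNormOn (Metric.thickening ϑ K) (nondegIndex f K) f).toReal ^ 2 +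
      nondegAmount f K / (2 : ℝ) ^ ((nondegIndex f K : ℤ) - 1))) / 2

variable {𝔤 : Type*} [LieRing 𝔤] [LieAlgebra ℂ 𝔤]

/-- The threshold `γ*`. -/
def gammaStar (g : Module.Basis (Fin l) ℂ 𝔤) (S : 𝔤 →ₗ⁅ℂ⁆ Matrix (Fin n) (Fin n) ℂ)
    (ω : ℕ → ℝ) (f : CSpace n → CSpace l) (K : Set (CSpace n)) (ϑ ε : ℝ) : ℝ :=
  min
    ((ε * ((n - 1).factorial : ℝ) /
        (constM f K ϑ *
          ((2 ^ 2 + (n : ℝ)) ^ n * ratioPow g S ω (nondegIndex f K) 2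
            - ((n : ℝ) + 1) * ratioPow g S ω (nondegIndex f K) 1
            + (n : ℝ) / 4 * supWeightedRatio g S ω (nondegIndex f K))))
      ^ ((nondegIndex f K : ℝ) / 2))
    (1 / supRatio g S ω * √(nondegAmount f K / (2 * (nondegIndex f K : ℝ) + 2)))

/-- `H(f̃)`: the set of `b ∈ K` such that `|α(∑ j, f̃_j(b) g_j)| ≥ γ ω_i` for all `i ≥ 1` and all
nonzero weights `α` of degree in `[2^(i-1) + 1, 2^i]`. -/
def diophantineSet (g : Module.Basis (Fin l) ℂ 𝔤) (S : 𝔤 →ₗ⁅ℂ⁆ Matrix (Fin n) (Fin n) ℂ)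
    (ω : ℕ → ℝ) (K : Set (CSpace n)) (γ : ℝ) (f' : CSpace n → CSpace l) : Set (CSpace n) :=
  {b ∈ K | ∀ i : ℕ, 1 ≤ i → ∀ α ∈ nonzeroWeights S (2 ^ (i - 1) + 1) (2 ^ i),
    γ * ω i ≤ ‖α (∑ j, f' b j • g j)‖}

end Constants

end

/-!
If the `k`-th derivative of a function of one real variable stays above `c` in absolute value, then
the function is at most `ε` in absolute value only on a set of measure `O((ε / c)^(1/k))`, because
`k + 1` well separated points of that set would give a small divided difference of order `k`.
By the choice of `μ₀` and `β`, at each point of `K` and for each unit vector `c` some directional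
derivative of `|(c, f)|²` of order at most `μ₀` is at least `β`; this persists on a ball whose
radius depends only on the `C^(μ₀+1)` norm, and it survives the passage to `f'`. Slicing the balls
along these directions and averaging over their centres bounds the volume of `{|(c, f')| < s}` in
`K` by `M s^(2/μ₀)`. Each weight in the `k`-th block therefore excludes a set of volume at most
`M γ^(2/μ₀) a_k`; there are `O(2^(kn))` such weights, so the strict diophantine condition makes the
total excluded volume finite, and `γ ≤ γ*` makes it at most `ε*`.
-/

/-! ### Sublevel sets of functions of one real variable -/

section Sublevel

variable {I : Set ℝ} {k : ℕ} {u : ℕ → ℝ → ℝ} {x : ℕ → ℝ} {ε h : ℝ}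

theorem exists_eq_zero_of_forall_hasDerivAt_of_zeros (hI : I.OrdConnected)
    (hu : ∀ j < k, ∀ t ∈ I, HasDerivAt (u j) (u (j + 1) t) t)
    (hx : ∀ i < k, x i < x (i + 1)) (hxI : ∀ i ≤ k, x i ∈ I) (hx0 : ∀ i ≤ k, u 0 (x i) = 0) :
    ∃ ξ ∈ I, u k ξ = 0 := by
  induction k generalizing u x with
  | zero => exact ⟨x 0, hxI 0 le_rfl, hx0 0 le_rfl⟩
  | succ k ih =>
    have hsub : ∀ i ≤ k, Set.Icc (x i) (x (i + 1)) ⊆ I := fun i hi =>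
      hI.out (hxI i (by omega)) (hxI (i + 1) (by omega))
    have hrolle : ∀ i ≤ k, ∃ ξ ∈ Set.Ioo (x i) (x (i + 1)), u 1 ξ = 0 := fun i hi =>
      exists_hasDerivAt_eq_zero (hx i (by omega))
        (fun t ht => (hu 0 (by omega) t (hsub i hi ht)).continuousAt.continuousWithinAt)
        (by rw [hx0 i (by omega), hx0 (i + 1) (by omega)])
        fun t ht => hu 0 (by omega) t (hsub i hi (Set.Ioo_subset_Icc_self ht))
    choose! y hy hy0 using hrolle
    exact ih (fun j hj => hu (j + 1) (by omega))
      (fun i hi => (hy i hi.le).2.trans (hy (i + 1) hi).1)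
      (fun i hi => hsub i hi (Set.Ioo_subset_Icc_self (hy i hi))) hy0

theorem exists_eq_factorial_mul_sum_div_prod_sub (hI : I.OrdConnected)
    (hu : ∀ j < k, ∀ t ∈ I, HasDerivAt (u j) (u (j + 1) t) t)
    (hx : ∀ i < k, x i < x (i + 1)) (hxI : ∀ i ≤ k, x i ∈ I)
    (hinj : Set.InjOn x (Finset.range (k + 1))) :
    ∃ ξ ∈ I, u k ξ = k.factorial * ∑ i ∈ Finset.range (k + 1),
      u 0 (x i) / ∏ j ∈ (Finset.range (k + 1)).erase i, (x i - x j) := by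
  set P := Lagrange.interpolate (Finset.range (k + 1)) x fun i => u 0 (x i)
  have hPx : ∀ i ∈ Finset.range (k + 1), P.eval (x i) = u 0 (x i) := fun i hi =>
    Lagrange.eval_interpolate_at_node _ hinj hi
  obtain ⟨ξ, hξI, hξ⟩ := exists_eq_zero_of_forall_hasDerivAt_of_zeros
    (u := fun j t => u j t - (Polynomial.derivative^[j] P).eval t) hI
    (fun j hj t ht => by
      rw [Function.iterate_succ_apply']
      exact (hu j hj t ht).sub (Polynomial.hasDerivAt _ t))
    hx hxI (fun i hi => by simp [hPx i (Finset.mem_range_succ_iff.2 hi)])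
  refine ⟨ξ, hξI, ?_⟩
  rw [sub_eq_zero.1 hξ, Lagrange.eval_iterate_derivative_eq_sum hinj
    (Lagrange.degree_interpolate_lt _ hinj) (by simp)]
  congr 1
  exact Finset.sum_congr rfl fun i hi => by rw [hPx i hi]; simp

theorem prod_erase_range_abs_sub {i : ℕ} (hi : i ≤ k) :
    ∏ j ∈ (Finset.range (k + 1)).erase i, |(i : ℝ) - j| = i.factorial * (k - i).factorial := by
  have hsplit : (Finset.range (k + 1)).erase i = Finset.range i ∪ Finset.Ico (i + 1) (k + 1) := by
    ext j
    simp only [Finset.mem_erase, Finset.mem_range, Finset.mem_union, Finset.mem_Ico]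
    omega
  have hdisj : Disjoint (Finset.range i) (Finset.Ico (i + 1) (k + 1)) := by
    rw [Finset.disjoint_left]
    intro j
    simp only [Finset.mem_range, Finset.mem_Ico]
    omega
  rw [hsplit, Finset.prod_union hdisj]
  congr 1
  · rw [← Finset.prod_range_add_one_eq_factorial, ← Finset.prod_range_reflect, Nat.cast_prod]
    refine Finset.prod_congr rfl fun j hj => ?_
    obtain ⟨m, rfl⟩ := Nat.exists_eq_add_of_lt (Finset.mem_range.1 hj)
    rw [show j + m + 1 - 1 - j = m by omega]
    push_cast
    rw [abs_of_nonneg] <;> ring_nf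
    positivity
  · rw [Finset.prod_Ico_eq_prod_range, ← Finset.prod_range_add_one_eq_factorial,
      Nat.add_sub_add_right, Nat.cast_prod]
    refine Finset.prod_congr rfl fun j _ => ?_
    rw [abs_sub_comm]
    push_cast
    rw [abs_of_nonneg] <;> ring_nf
    positivity

theorem mul_abs_sub_le_abs_sub_of_spaced (hx : ∀ i < k, x i + h ≤ x (i + 1)) {i j : ℕ}
    (hi : i ≤ k) (hj : j ≤ k) : h * |(i : ℝ) - j| ≤ |x i - x j| := by
  wlog hij : i ≤ j generalizing i j
  · rw [abs_sub_comm, abs_sub_comm (x i)]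
    exact this hj hi (le_of_not_ge hij)
  have hle : h * ((j : ℝ) - i) ≤ x j - x i := by
    induction j, hij using Nat.le_induction with
    | base => simp
    | succ j _ ih =>
      have := ih (by omega)
      have := hx j (by omega)
      push_cast
      linarith
  rw [abs_sub_comm, abs_sub_comm (x i), abs_of_nonneg (sub_nonneg.2 (Nat.cast_le.2 hij))]
  exact hle.trans (le_abs_self _)

theorem injOn_range_of_spaced (hh : 0 < h) (hx : ∀ i < k, x i + h ≤ x (i + 1)) :
    Set.InjOn x (Finset.range (k + 1)) := by
  intro i hi j hj hij
  simp only [Finset.coe_range, Set.mem_Iio, Nat.lt_succ_iff] at hi hj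
  have hle := mul_abs_sub_le_abs_sub_of_spaced hx hi hj
  rw [hij, sub_self, abs_zero] at hle
  have h0 : |(i : ℝ) - j| = 0 := (nonpos_of_mul_nonpos_right hle hh).antisymm (abs_nonneg _)
  exact_mod_cast sub_eq_zero.1 (abs_eq_zero.1 h0)

theorem pow_mul_factorial_le_prod_abs_sub_of_spaced (hh : 0 ≤ h)
    (hx : ∀ i < k, x i + h ≤ x (i + 1)) {i : ℕ} (hi : i ≤ k) :
    h ^ k * (i.factorial * (k - i).factorial) ≤
      ∏ j ∈ (Finset.range (k + 1)).erase i, |x i - x j| := by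
  have hcard : ((Finset.range (k + 1)).erase i).card = k := by
    simp [Finset.card_erase_of_mem (Finset.mem_range_succ_iff.2 hi)]
  calc h ^ k * (i.factorial * (k - i).factorial)
      = ∏ j ∈ (Finset.range (k + 1)).erase i, h * |(i : ℝ) - j| := by
        rw [Finset.prod_mul_distrib, Finset.prod_const, hcard, prod_erase_range_abs_sub hi]
    _ ≤ _ := Finset.prod_le_prod (fun j _ => by positivity) fun j hj =>
        mul_abs_sub_le_abs_sub_of_spaced hx hi
          (Finset.mem_range_succ_iff.1 (Finset.mem_of_mem_erase hj))

theorem exists_abs_mul_pow_le_of_spaced (hI : I.OrdConnected)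
    (hu : ∀ j < k, ∀ t ∈ I, HasDerivAt (u j) (u (j + 1) t) t) (hh : 0 < h)
    (hx : ∀ i < k, x i + h ≤ x (i + 1)) (hxI : ∀ i ≤ k, x i ∈ I)
    (hxε : ∀ i ≤ k, |u 0 (x i)| ≤ ε) :
    ∃ ξ ∈ I, |u k ξ| * h ^ k ≤ 2 ^ k * ε := by
  obtain ⟨ξ, hξI, hξ⟩ := exists_eq_factorial_mul_sum_div_prod_sub hI hu
    (fun i hi => by linarith [hx i hi]) hxI (injOn_range_of_spaced hh hx)
  have hε : 0 ≤ ε := (abs_nonneg _).trans (hxε 0 k.zero_le)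
  have hterm : ∀ i ∈ Finset.range (k + 1),
      |u 0 (x i) / ∏ j ∈ (Finset.range (k + 1)).erase i, (x i - x j)|
        ≤ ε / h ^ k * (k.choose i / k.factorial) := fun i hi => by
    have hik := Finset.mem_range_succ_iff.1 hi
    rw [abs_div, Finset.abs_prod]
    calc |u 0 (x i)| / _ ≤ ε / (h ^ k * (i.factorial * (k - i).factorial)) :=
          div_le_div₀ hε (hxε i hik) (by positivity)
            (pow_mul_factorial_le_prod_abs_sub_of_spaced hh.le hx hik)
      _ = _ := by
          rw [Nat.cast_choose ℝ hik]
          field_simp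
  have hchoose : ∑ i ∈ Finset.range (k + 1), (k.choose i : ℝ) = 2 ^ k := by
    exact_mod_cast Nat.sum_range_choose k
  refine ⟨ξ, hξI, ?_⟩
  calc |u k ξ| * h ^ k
      ≤ k.factorial * (∑ i ∈ Finset.range (k + 1), ε / h ^ k * (k.choose i / k.factorial))
        * h ^ k := by
        rw [hξ, abs_mul, Nat.abs_cast]
        gcongr
        exact (Finset.abs_sum_le_sum_abs _ _).trans (Finset.sum_le_sum hterm)
    _ = 2 ^ k * ε := by
        rw [← Finset.mul_sum, ← Finset.sum_div, hchoose]
        field_simp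

theorem exists_mem_lt_volume_inter_Ici_add {E : Set ℝ} (hh : 0 < h) (hE : BddBelow E)
    {v : ℝ} (hv : 0 ≤ v) (hvE : ENNReal.ofReal (v + h) < volume E) :
    ∃ x₀ ∈ E, ENNReal.ofReal v < volume (E ∩ Set.Ici (x₀ + h)) := by
  obtain ⟨η, hη, hηE⟩ : ∃ η > 0, ENNReal.ofReal (v + h + η) < volume E := by
    have hcont : Tendsto (fun η : ℝ => ENNReal.ofReal (v + h + η)) (𝓝[>] 0)
        (𝓝 (ENNReal.ofReal (v + h + 0))) :=
      ((ENNReal.continuous_ofReal.comp (continuous_const.add continuous_id)).tendsto 0).mono_left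
        nhdsWithin_le_nhds
    obtain ⟨η, hlt, hη⟩ :=
      ((hcont.eventually_lt_const (by simpa using hvE)).and self_mem_nhdsWithin).exists
    exact ⟨η, hη, hlt⟩
  have hne : E.Nonempty := nonempty_of_measure_ne_zero (pos_of_gt hvE).ne'
  obtain ⟨x₀, hx₀E, hx₀⟩ := exists_lt_of_csInf_lt hne (lt_add_of_pos_right (sInf E) hη)
  refine ⟨x₀, hx₀E, ?_⟩
  by_contra! hle
  have hcover : E ⊆ Set.Icc (sInf E) (x₀ + h) ∪ (E ∩ Set.Ici (x₀ + h)) := fun t ht =>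
    (le_total t (x₀ + h)).imp (fun htx => ⟨csInf_le hE ht, htx⟩) fun htx => ⟨ht, htx⟩
  have hE_le : volume E ≤ ENNReal.ofReal (v + h + η) :=
    calc volume E ≤ volume (Set.Icc (sInf E) (x₀ + h)) + volume (E ∩ Set.Ici (x₀ + h)) :=
          (measure_mono hcover).trans (measure_union_le _ _)
      _ ≤ ENNReal.ofReal (η + h) + ENNReal.ofReal v := by
          rw [Real.volume_Icc]
          gcongr
          linarith
      _ = ENNReal.ofReal (v + h + η) := by
          rw [← ENNReal.ofReal_add (by positivity) hv]
          ring_nf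
  exact hE_le.not_gt hηE

theorem exists_spaced_of_lt_volume {E : Set ℝ} (hh : 0 < h) (hE : BddBelow E)
    (hkE : ENNReal.ofReal (k * h) < volume E) :
    ∃ x : ℕ → ℝ, (∀ i < k, x i + h ≤ x (i + 1)) ∧ ∀ i ≤ k, x i ∈ E := by
  induction k generalizing E with
  | zero =>
    obtain ⟨t, ht⟩ := nonempty_of_measure_ne_zero (pos_of_gt hkE).ne'
    exact ⟨fun _ => t, by simp, fun _ _ => ht⟩
  | succ k ih =>
    obtain ⟨x₀, hx₀, hlt⟩ := exists_mem_lt_volume_inter_Ici_add hh hE (v := k * h) (by positivity)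
      (by rwa [Nat.cast_succ, add_one_mul] at hkE)
    obtain ⟨x, hx, hxE⟩ := ih (hE.mono Set.inter_subset_left) hlt
    refine ⟨fun i => Nat.casesOn i x₀ x, ?_, ?_⟩
    · rintro (_ | i) hi
      · exact (hxE 0 k.zero_le).2
      · exact hx i (by omega)
    · rintro (_ | i) hi
      · exact hx₀
      · exact (hxE i (by omega)).1

theorem volume_le_of_forall_abs_le_of_le_abs_deriv (hI : I.OrdConnected) (hIb : BddBelow I)
    (hu : ∀ j < k, ∀ t ∈ I, HasDerivAt (u j) (u (j + 1) t) t) {c : ℝ}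
    (hc : ∀ t ∈ I, c ≤ |u k t|) (hh : 0 < h) (hlt : 2 ^ k * ε < c * h ^ k) {E : Set ℝ}
    (hE : E ⊆ I) (hEε : ∀ t ∈ E, |u 0 t| ≤ ε) : volume E ≤ ENNReal.ofReal (k * h) := by
  by_contra! hcon
  obtain ⟨x, hx, hxE⟩ := exists_spaced_of_lt_volume hh (hIb.mono hE) hcon
  obtain ⟨ξ, hξI, hξ⟩ := exists_abs_mul_pow_le_of_spaced hI hu hh hx
    (fun i hi => hE (hxE i hi)) fun i hi => hEε _ (hxE i hi)
  have := mul_le_mul_of_nonneg_right (hc ξ hξI) (by positivity : 0 ≤ h ^ k)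
  linarith

end Sublevel

/-! ### Symmetry of the iterated derivative of a function of finite smoothness -/

section SymmetricDerivatives

variable {𝕜 E F : Type*} [RCLike 𝕜] [NormedAddCommGroup E] [NormedSpace 𝕜 E]
  [NormedAddCommGroup F] [NormedSpace 𝕜 F] {n : ℕ} {h : E → F} {y : E}

theorem fderiv_iteratedFDeriv_apply (hd : DifferentiableAt 𝕜 (iteratedFDeriv 𝕜 n h) y)
    (w : Fin n → E) (b : E) :
    fderiv 𝕜 (iteratedFDeriv 𝕜 n h) y b w = fderiv 𝕜 (fun z => iteratedFDeriv 𝕜 n h z w) y b :=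
  (congrArg (· b) ((ContinuousMultilinearMap.apply 𝕜 (fun _ : Fin n => E) F w).hasFDerivAt.comp y
    hd.hasFDerivAt).fderiv).symm

theorem iteratedFDeriv_add_two_apply (hh : ContDiffAt 𝕜 (n + 2 : ℕ) h y) (w : Fin (n + 2) → E) :
    iteratedFDeriv 𝕜 (n + 2) h y w =
      fderiv 𝕜 (fderiv 𝕜 (iteratedFDeriv 𝕜 n h)) y (w 0) (w 1) (Fin.tail (Fin.tail w)) := by
  have hd : ContDiffAt 𝕜 2 (iteratedFDeriv 𝕜 n h) y :=
    hh.iteratedFDeriv_right (by norm_cast; omega)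
  have hd1 : DifferentiableAt 𝕜 (fderiv 𝕜 (iteratedFDeriv 𝕜 n h)) y :=
    (hd.fderiv_right (m := 1) (by norm_num)).differentiableAt (by simp)
  have hcomp := ((ContinuousMultilinearMap.apply 𝕜 (fun _ : Fin n => E) F
    (Fin.tail (Fin.tail w))).hasFDerivAt.comp y
      (hd1.hasFDerivAt.clm_apply (hasFDerivAt_const (w 1) y))).fderiv
  rw [iteratedFDeriv_succ_apply_left, fderiv_iteratedFDeriv_apply
    (hh.differentiableAt_iteratedFDeriv (by norm_cast; omega))]
  refine (congrArg (· (w 0)) hcomp).trans ?_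
  simp

theorem iteratedFDeriv_comp_swap_zero_one (hh : ContDiffAt 𝕜 (n + 2 : ℕ) h y)
    (v : Fin (n + 2) → E) :
    iteratedFDeriv 𝕜 (n + 2) h y (v ∘ Equiv.swap 0 1) = iteratedFDeriv 𝕜 (n + 2) h y v := by
  have hd : ContDiffAt 𝕜 2 (iteratedFDeriv 𝕜 n h) y :=
    hh.iteratedFDeriv_right (by norm_cast; omega)
  have htail : Fin.tail (Fin.tail (v ∘ Equiv.swap 0 1)) = Fin.tail (Fin.tail v) := by
    funext k
    have : Equiv.swap (0 : Fin (n + 2)) 1 k.succ.succ = k.succ.succ :=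
      Equiv.swap_apply_of_ne_of_ne (by simp [Fin.ext_iff]) (by simp [Fin.ext_iff])
    simp only [Fin.tail, Function.comp, this]
  rw [iteratedFDeriv_add_two_apply hh, iteratedFDeriv_add_two_apply hh, htail,
    (hd.isSymmSndFDerivAt (by simp)).eq]
  simp

theorem iteratedFDeriv_succ_apply_congr_tail (hh : ContDiffAt 𝕜 (n + 1 : ℕ) h y)
    {v w : Fin (n + 1) → E} (h0 : v 0 = w 0)
    (htail : ∀ᶠ z in 𝓝 y, iteratedFDeriv 𝕜 n h z (Fin.tail v) =
      iteratedFDeriv 𝕜 n h z (Fin.tail w)) :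
    iteratedFDeriv 𝕜 (n + 1) h y v = iteratedFDeriv 𝕜 (n + 1) h y w := by
  have hd : DifferentiableAt 𝕜 (iteratedFDeriv 𝕜 n h) y :=
    hh.differentiableAt_iteratedFDeriv (by norm_cast; omega)
  rw [iteratedFDeriv_succ_apply_left, iteratedFDeriv_succ_apply_left,
    fderiv_iteratedFDeriv_apply hd, fderiv_iteratedFDeriv_apply hd, h0,
    Filter.EventuallyEq.fderiv_eq htail]

/-- Mathlib's `ContDiffAt.iteratedFDeriv_comp_perm` is for analytic functions. Here adjacent
transpositions suffice: the one of the first two indices is the symmetry of the second derivative,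
the other ones only concern the last `n` indices. -/
theorem iteratedFDeriv_comp_perm_of_contDiffAt (hh : ContDiffAt 𝕜 n h y)
    (v : Fin n → E) (σ : Equiv.Perm (Fin n)) :
    iteratedFDeriv 𝕜 n h y (v ∘ σ) = iteratedFDeriv 𝕜 n h y v := by
  induction n generalizing y with
  | zero => exact congrArg _ (Subsingleton.elim _ _)
  | succ n ih =>
    have hσ : σ ∈ Submonoid.closure
        (Set.range fun i : Fin n => Equiv.swap i.castSucc i.succ) := by
      rw [Equiv.Perm.mclosure_swap_castSucc_succ]
      trivial
    induction hσ using Submonoid.closure_induction generalizing v with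
    | one => rfl
    | mul σ τ _ _ hσ hτ => rw [Equiv.Perm.coe_mul, ← Function.comp_assoc, hτ, hσ]
    | mem σ hσ =>
      obtain ⟨i, rfl⟩ := hσ
      obtain ⟨n, rfl⟩ : ∃ m, n = m + 1 := ⟨n - 1, by have := i.pos; omega⟩
      refine Fin.cases (iteratedFDeriv_comp_swap_zero_one hh v) (fun j => ?_) i
      have htail : Fin.tail (v ∘ Equiv.swap j.succ.castSucc j.succ.succ) =
          Fin.tail v ∘ Equiv.swap j.castSucc j.succ := by
        funext k
        simp only [Fin.tail, Function.comp]
        rw [← (Fin.succ_injective _).swap_apply, Fin.succ_castSucc]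
      refine iteratedFDeriv_succ_apply_congr_tail hh
        (congrArg v (Equiv.swap_apply_of_ne_of_ne (by simp [Fin.ext_iff]) (by simp [Fin.ext_iff])))
        ?_
      filter_upwards [(hh.of_le (by norm_cast; omega) : ContDiffAt 𝕜 (n + 1 : ℕ) h y).eventually
        (by simp)] with z hz
      rw [htail, ih hz]

end SymmetricDerivatives

/-! ### Smoothness of holomorphic maps of several variables -/

section Holomorphic

variable {E F : Type*} [NormedAddCommGroup E] [NormedSpace ℂ E] [NormedAddCommGroup F]
  [NormedSpace ℂ F] {U : Set E} {f : E → F}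

theorem exists_norm_fderiv_le_on_cthickening [ProperSpace E] (hU : IsOpen U)
    (hf : DifferentiableOn ℂ f U) {K : Set E} (hK : IsCompact K) (hKU : K ⊆ U) :
    ∃ ε > 0, ∃ C, Metric.cthickening ε K ⊆ U ∧
      ∀ z ∈ Metric.cthickening ε K, ‖fderiv ℂ f z‖ ≤ C := by
  obtain ⟨δ, hδ, hδU⟩ := hK.exists_cthickening_subset_open hU hKU
  obtain ⟨M, hM⟩ := hK.cthickening.exists_bound_of_continuousOn (hf.continuousOn.mono hδU)
  refine ⟨δ / 2, by positivity, (2 * M + 1) / (δ / 2),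
    (Metric.cthickening_mono (by linarith) K).trans hδU, fun z hz => ?_⟩
  have hball : Metric.ball z (δ / 2) ⊆ Metric.cthickening δ K := fun w hw => by
    have hw' : w ∈ Metric.cthickening (δ / 2) (Metric.cthickening (δ / 2) K) :=
      Metric.mem_cthickening_of_dist_le _ _ _ _ hz (Metric.mem_ball.1 hw).le
    simpa only [add_halves] using
      Metric.cthickening_cthickening_subset (by positivity) (by positivity) K hw'
  refine Complex.norm_fderiv_le_div_of_mapsTo_ball (hf.mono (hball.trans hδU)) (fun w hw => ?_)
    (by positivity)
  have hfw := hM w (hball hw)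
  have hfz := hM z (hball (Metric.mem_ball_self (by positivity)))
  rw [Metric.mem_closedBall, dist_eq_norm]
  linarith [norm_sub_le (f w) (f z)]

theorem fderiv_apply_eq_circleIntegral [CompleteSpace F] (hU : IsOpen U)
    (hf : DifferentiableOn ℂ f U) {z v : E} {r : ℝ} (hr : 0 < r)
    (hdisc : ∀ t ∈ Metric.closedBall (0 : ℂ) r, z + t • v ∈ U) :
    fderiv ℂ f z v =
      (2 * Real.pi * Complex.I : ℂ)⁻¹ • ∮ t in C(0, r), (t ^ 2)⁻¹ • f (z + t • v) := by
  have hz : z ∈ U := by simpa using hdisc 0 (Metric.mem_closedBall_self hr.le)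
  have hcauchy := Complex.two_pi_I_inv_smul_circleIntegral_sub_sq_inv_smul_of_differentiable
    (f := fun t : ℂ => f (z + t • v))
    (hU.preimage (by fun_prop : Continuous fun t : ℂ => z + t • v)) hdisc
    (hf.comp (by fun_prop) fun _ ht => ht) (Metric.mem_ball_self hr)
  have hline : HasDerivAt (fun t : ℂ => z + t • v) v 0 := by
    simpa using ((hasDerivAt_id (0 : ℂ)).smul_const v).const_add z
  have hfz : HasFDerivAt f (fderiv ℂ f z) (z + (0 : ℂ) • v) := by
    rw [zero_smul, add_zero]
    exact (hf.differentiableAt (hU.mem_nhds hz)).hasFDerivAt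
  simpa only [sub_zero, ← (hfz.comp_hasDerivAt (0 : ℂ) hline).deriv] using! hcauchy.symm

theorem differentiableAt_circleIntegral_smul_comp_add_smul [FiniteDimensional ℂ E]
    [FiniteDimensional ℂ F] (hU : IsOpen U) (hf : DifferentiableOn ℂ f U) {z₀ v : E} {r : ℝ}
    (hr : 0 < r) (hcircle : ∀ t ∈ Metric.sphere (0 : ℂ) r, z₀ + t • v ∈ U) {w : ℂ → ℂ}
    (hw : ContinuousOn w (Metric.sphere 0 r)) :
    DifferentiableAt ℂ (fun z => ∮ t in C(0, r), w t • f (z + t • v)) z₀ := by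
  have : ProperSpace E := FiniteDimensional.proper ℂ E
  borelize E F (E →L[ℂ] F)
  have hmem : ∀ θ, circleMap 0 r θ ∈ Metric.sphere (0 : ℂ) r := circleMap_mem_sphere 0 hr.le
  obtain ⟨ε, hε, C, hεU, hC⟩ := exists_norm_fderiv_le_on_cthickening hU hf
    ((isCompact_sphere (0 : ℂ) r).image (by fun_prop : Continuous fun t : ℂ => z₀ + t • v))
    (Set.image_subset_iff.2 hcircle)
  have hthick : ∀ z ∈ Metric.ball z₀ ε, ∀ θ, z + circleMap 0 r θ • v ∈
      Metric.cthickening ε ((fun t : ℂ => z₀ + t • v) '' Metric.sphere 0 r) := fun z hz θ =>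
    Metric.mem_cthickening_of_dist_le _ _ _ _ (Set.mem_image_of_mem _ (hmem θ))
      (by simpa using (Metric.mem_ball.1 hz).le)
  have hpath : ∀ z : E, Continuous fun θ => z + circleMap 0 r θ • v := fun z =>
    continuous_const.add ((continuous_circleMap 0 r).smul continuous_const)
  have hc : Continuous fun θ => deriv (circleMap 0 r) θ * w (circleMap 0 r θ) := by
    simp only [deriv_circleMap]
    exact ((continuous_circleMap 0 r).mul continuous_const).mul
      (hw.comp_continuous (continuous_circleMap 0 r) hmem)
  have hcont : ∀ z ∈ Metric.ball z₀ ε, Continuous fun θ =>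
      (deriv (circleMap 0 r) θ * w (circleMap 0 r θ)) • f (z + circleMap 0 r θ • v) := fun z hz =>
    hc.smul (hf.continuousOn.comp_continuous (hpath z) fun θ => hεU (hthick z hz θ))
  simp only [circleIntegral, smul_smul]
  refine (intervalIntegral.hasFDerivAt_integral_of_dominated_of_fderiv_le
    (F' := fun z θ => (deriv (circleMap 0 r) θ * w (circleMap 0 r θ)) •
      fderiv ℂ f (z + circleMap 0 r θ • v))
    (bound := fun θ => ‖deriv (circleMap 0 r) θ * w (circleMap 0 r θ)‖ * C)
    (Metric.ball_mem_nhds z₀ hε) ?_ ((hcont z₀ (Metric.mem_ball_self hε)).intervalIntegrable _ _)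
    (hc.aestronglyMeasurable.smul
      ((measurable_fderiv ℂ f).comp (hpath z₀).measurable).aestronglyMeasurable) ?_
    ((hc.norm.mul continuous_const).intervalIntegrable _ _) ?_).differentiableAt
  · filter_upwards [Metric.ball_mem_nhds z₀ hε] with z hz using (hcont z hz).aestronglyMeasurable
  · refine Eventually.of_forall fun θ _ z hz => ?_
    rw [norm_smul]
    gcongr
    exact hC _ (hthick z hz θ)
  · refine Eventually.of_forall fun θ _ z hz => ?_
    have hfd := (hf.differentiableAt (hU.mem_nhds (hεU (hthick z hz θ)))).hasFDerivAt
    exact ((hasFDerivAt_comp_add_right _).2 hfd).const_smul _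

theorem exists_pos_forall_add_smul_mem (hU : IsOpen U) {z₀ : E} (hz₀ : z₀ ∈ U) (v : E) :
    ∃ r > 0, ∀ᶠ z in 𝓝 z₀, ∀ t ∈ Metric.closedBall (0 : ℂ) r, z + t • v ∈ U := by
  have hU' : U ∈ 𝓝 (z₀ + (0 : ℂ) • v) := by simpa using hU.mem_nhds hz₀
  have hcont : Tendsto (fun p : E × ℂ => p.1 + p.2 • v) (𝓝 z₀ ×ˢ 𝓝 0) (𝓝 (z₀ + (0 : ℂ) • v)) := by
    rw [← nhds_prod_eq]
    exact (by fun_prop : Continuous fun p : E × ℂ => p.1 + p.2 • v).tendsto (z₀, 0)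
  obtain ⟨s, hs, t, ht, hst⟩ := Filter.eventually_prod_iff.1 (hcont.eventually hU')
  obtain ⟨r, hr, hrt⟩ := Metric.nhds_basis_closedBall.eventually_iff.1 ht
  exact ⟨r, hr, hs.mono fun z hz _ hw => hst hz (hrt hw)⟩

theorem differentiableOn_fderiv_apply [FiniteDimensional ℂ E] [FiniteDimensional ℂ F]
    (hU : IsOpen U) (hf : DifferentiableOn ℂ f U) (v : E) :
    DifferentiableOn ℂ (fun z => fderiv ℂ f z v) U := fun z₀ hz₀ => by
  have : CompleteSpace F := FiniteDimensional.complete ℂ F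
  obtain ⟨r, hr, hdisc⟩ := exists_pos_forall_add_smul_mem hU hz₀ v
  have hw : ContinuousOn (fun t : ℂ => (t ^ 2)⁻¹) (Metric.sphere 0 r) :=
    ContinuousOn.inv₀ (by fun_prop) fun t ht =>
      pow_ne_zero 2 (ne_zero_of_mem_sphere hr.ne' ⟨t, ht⟩)
  have hint := differentiableAt_circleIntegral_smul_comp_add_smul hU hf hr
    (fun t ht => hdisc.self_of_nhds t (Metric.sphere_subset_closedBall ht)) hw
  refine ((hint.const_smul (2 * Real.pi * Complex.I : ℂ)⁻¹).congr_of_eventuallyEq ?_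
    ).differentiableWithinAt
  filter_upwards [hdisc] with z hz using fderiv_apply_eq_circleIntegral hU hf hr hz

theorem contDiffOn_of_differentiableOn_complex [FiniteDimensional ℂ E] [FiniteDimensional ℂ F]
    (hU : IsOpen U) (hf : DifferentiableOn ℂ f U) (m : ℕ) : ContDiffOn ℂ m f U := by
  induction m generalizing f with
  | zero => exact contDiffOn_zero.2 hf.continuousOn
  | succ m ih =>
    push_cast
    refine (contDiffOn_succ_iff_fderiv_apply hU.uniqueDiffOn).2 ⟨hf, by simp, fun v => ?_⟩
    exact (ih (differentiableOn_fderiv_apply hU hf v)).congr fun z hz => by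
      rw [fderivWithin_of_isOpen hU hz]

end Holomorphic

/-! ### Symmetric multilinear maps on the diagonal -/

section Polarization

variable {E F : Type*} [NormedAddCommGroup E] [NormedSpace ℝ E]
  [NormedAddCommGroup F] [NormedSpace ℝ F]

/-- The polarization constant `q ^ q / q!`, which bounds the norm of a symmetric `q`-linear map by
the supremum of its values on the diagonal of the unit sphere. -/
noncomputable def polarConst (q : ℕ) : ℝ := (q : ℝ) ^ q / q.factorial

theorem polarConst_nonneg (q : ℕ) : 0 ≤ polarConst q := by unfold polarConst; positivity

theorem monotone_polarConst : Monotone polarConst := by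
  refine monotone_nat_of_le_succ fun q => ?_
  unfold polarConst
  rw [div_le_div_iff₀ (by positivity) (by positivity), Nat.factorial_succ]
  have hpow : (q : ℝ) ^ q ≤ (q + 1) ^ q := by gcongr; linarith
  push_cast
  calc (q : ℝ) ^ q * ((q + 1) * q.factorial) ≤ (q + 1) ^ q * ((q + 1) * q.factorial) := by gcongr
    _ = (q + 1) ^ (q + 1) * q.factorial := by ring

theorem two_le_polarConst {q : ℕ} (hq : 2 ≤ q) : 2 ≤ polarConst q :=
  le_trans (by norm_num [polarConst]) (monotone_polarConst hq)

theorem sum_signs_prod {q : ℕ} (κ : Fin q → Fin q) :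
    ∑ e ∈ Fintype.piFinset (fun _ : Fin q => ({1, -1} : Finset ℝ)),
      (∏ i, e i) * ∏ m, e (κ m) = if Function.Bijective κ then 2 ^ q else 0 := by
  have hfiber : ∀ e : Fin q → ℝ, (∏ i, e i) * ∏ m, e (κ m) =
      ∏ i, e i ^ (1 + (Finset.univ.filter (fun m => κ m = i)).card) := fun e => by
    rw [← Finset.prod_fiberwise (s := Finset.univ) (g := κ) (f := fun m => e (κ m)),
      ← Finset.prod_mul_distrib]
    refine Finset.prod_congr rfl fun i _ => ?_
    rw [pow_add, pow_one, Finset.prod_congr rfl (g := fun _ => e i), Finset.prod_const]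
    intro m hm
    rw [(Finset.mem_filter.1 hm).2]
  simp_rw [hfiber]
  rw [← Finset.prod_univ_sum (fun _ : Fin q => ({1, -1} : Finset ℝ))
    (fun i x => x ^ (1 + (Finset.univ.filter (fun m => κ m = i)).card))]
  simp_rw [Finset.sum_pair (show (1 : ℝ) ≠ -1 by norm_num)]
  split_ifs with hκ
  · rw [Finset.prod_congr rfl (g := fun _ => (2 : ℝ)), Finset.prod_const, Finset.card_univ,
      Fintype.card_fin]
    intro i _
    obtain ⟨m, rfl⟩ := hκ.2 i
    have : Finset.univ.filter (fun m' => κ m' = κ m) = {m} := by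
      ext m'; simp [hκ.1.eq_iff]
    rw [this]; norm_num
  · obtain ⟨i, hi⟩ : ∃ i, ∀ m, κ m ≠ i := by
      simpa [Function.Surjective] using fun h => hκ (Finite.surjective_iff_bijective.1 h)
    refine Finset.prod_eq_zero (Finset.mem_univ i) ?_
    have : Finset.univ.filter (fun m => κ m = i) = ∅ := by
      ext m; simp [hi m]
    rw [this]; norm_num

theorem card_filter_bijective (q : ℕ) :
    (Finset.univ.filter fun κ : Fin q → Fin q => Function.Bijective κ).card = q.factorial := by
  rw [← Fintype.card_subtype, Fintype.card_congr (Equiv.ofBijective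
    (fun κ : {κ : Fin q → Fin q // Function.Bijective κ} => Equiv.ofBijective κ.1 κ.2)
    ⟨fun _ _ h => Subtype.ext (congrArg (fun e : Equiv.Perm (Fin q) => ⇑e) h),
      fun σ => ⟨⟨σ, σ.bijective⟩, Equiv.ext fun _ => rfl⟩⟩), Fintype.card_perm, Fintype.card_fin]

theorem sum_signs_smul_diagonal {q : ℕ} (T : ContinuousMultilinearMap ℝ (fun _ : Fin q => E) F)
    (hT : ∀ (v : Fin q → E) (σ : Equiv.Perm (Fin q)), T (v ∘ σ) = T v) (v : Fin q → E) :
    ∑ e ∈ Fintype.piFinset (fun _ : Fin q => ({1, -1} : Finset ℝ)),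
      (∏ i, e i) • (T fun _ => ∑ i, e i • v i) = ((2 : ℝ) ^ q * q.factorial) • T v := by
  have hexpand : ∀ e : Fin q → ℝ, (T fun _ => ∑ i, e i • v i) =
      ∑ κ : Fin q → Fin q, (∏ m, e (κ m)) • T (v ∘ κ) := fun e => by
    rw [T.map_sum]
    refine Finset.sum_congr rfl fun κ _ => ?_
    rw [← T.map_smul_univ]
    rfl
  have hbij : ∀ κ ∈ Finset.univ.filter (fun κ : Fin q → Fin q => Function.Bijective κ),
      (2 : ℝ) ^ q • T (v ∘ κ) = (2 : ℝ) ^ q • T v := fun κ hκ => by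
    rw [← hT v (Equiv.ofBijective κ (Finset.mem_filter.1 hκ).2)]
    rfl
  simp_rw [hexpand, Finset.smul_sum, smul_smul]
  rw [Finset.sum_comm]
  simp_rw [← Finset.sum_smul, sum_signs_prod, ite_smul, zero_smul]
  rw [← Finset.sum_filter, Finset.sum_congr rfl hbij, Finset.sum_const, card_filter_bijective,
    ← Nat.cast_smul_eq_nsmul ℝ, smul_smul, mul_comm]

theorem norm_le_polarConst_mul {q : ℕ} (T : ContinuousMultilinearMap ℝ (fun _ : Fin q => E) F)
    (hT : ∀ (v : Fin q → E) (σ : Equiv.Perm (Fin q)), T (v ∘ σ) = T v) {C : ℝ} (hC0 : 0 ≤ C)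
    (hC : ∀ a : E, ‖T fun _ => a‖ ≤ C * ‖a‖ ^ q) {v : Fin q → E} (hv : ∀ i, ‖v i‖ ≤ 1) :
    ‖T v‖ ≤ polarConst q * C := by
  have hterm : ∀ e ∈ Fintype.piFinset (fun _ : Fin q => ({1, -1} : Finset ℝ)),
      ‖(∏ i, e i) • (T fun _ => ∑ i, e i • v i)‖ ≤ C * (q : ℝ) ^ q := fun e he => by
    have hunit : ∀ i, ‖e i‖ = 1 := fun i => by
      have hi := Fintype.mem_piFinset.1 he i
      rw [Finset.mem_insert, Finset.mem_singleton] at hi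
      rcases hi with hi | hi <;> simp [hi]
    have hsum : ‖∑ i, e i • v i‖ ≤ q := by
      simpa using norm_sum_le_of_le Finset.univ fun i _ =>
        show ‖e i • v i‖ ≤ 1 by rw [norm_smul, hunit, one_mul]; exact hv i
    rw [norm_smul, norm_prod, Finset.prod_congr rfl fun i _ => hunit i, Finset.prod_const_one,
      one_mul]
    exact (hC _).trans (by gcongr)
  have hcard : (Fintype.piFinset fun _ : Fin q => ({1, -1} : Finset ℝ)).card = 2 ^ q := by
    rw [Fintype.card_piFinset, Finset.prod_const, Finset.card_univ, Fintype.card_fin,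
      Finset.card_pair (by norm_num)]
  have hbound : ‖((2 : ℝ) ^ q * q.factorial) • T v‖ ≤ 2 ^ q * (C * (q : ℝ) ^ q) := by
    rw [← sum_signs_smul_diagonal T hT]
    refine (norm_sum_le_of_le _ hterm).trans_eq ?_
    rw [Finset.sum_const, hcard, nsmul_eq_mul]
    push_cast
    rfl
  rw [norm_smul, Real.norm_of_nonneg (by positivity), mul_assoc] at hbound
  rw [polarConst, div_mul_eq_mul_div, le_div_iff₀ (by positivity)]
  linarith [le_of_mul_le_mul_left hbound (by positivity)]

theorem norm_diagonal_le_mul_pow {q : ℕ}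
    (T : ContinuousMultilinearMap ℝ (fun _ : Fin (q + 1) => E) F) {C : ℝ}
    (hC : ∀ b : E, ‖b‖ = 1 → ‖T fun _ => b‖ ≤ C) (b : E) :
    ‖T fun _ => b‖ ≤ C * ‖b‖ ^ (q + 1) := by
  rcases eq_or_ne b 0 with rfl | hb
  · rw [T.map_coord_zero 0 rfl]
    simp
  · have hb' : ‖b‖ ≠ 0 := norm_ne_zero_iff.2 hb
    have hscale : (T fun _ => b) = ‖b‖ ^ (q + 1) • T fun _ => ‖b‖⁻¹ • b := by
      have := T.map_smul_univ (fun _ => ‖b‖) (fun _ => ‖b‖⁻¹ • b)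
      simpa [smul_smul, mul_inv_cancel₀ hb'] using this
    rw [hscale, norm_smul, norm_pow, norm_norm, mul_comm]
    gcongr
    exact hC _ (by rw [norm_smul, norm_inv, norm_norm, inv_mul_cancel₀ hb'])

end Polarization

/-! ### Derivatives in one direction -/

section Directional

variable {E F G H : Type*} [NormedAddCommGroup E] [NormedSpace ℝ E]
  [NormedAddCommGroup F] [NormedSpace ℝ F] [NormedAddCommGroup G] [NormedSpace ℝ G]
  [NormedAddCommGroup H] [NormedSpace ℝ H]

/-- The `j`-th derivative `D^j h(y)(a, …, a)` of `h` at `y` in the direction `a`. -/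
noncomputable def dirDeriv (j : ℕ) (h : E → F) (a y : E) : F := iteratedFDeriv ℝ j h y fun _ => a

theorem hasFDerivAt_dirDeriv {j : ℕ} {h : E → F} {y : E} (hh : ContDiffAt ℝ (j + 1) h y) (a : E) :
    HasFDerivAt (dirDeriv j h a)
      ((ContinuousMultilinearMap.apply ℝ (fun _ : Fin j => E) F (fun _ => a)).comp
        (fderiv ℝ (iteratedFDeriv ℝ j h) y)) y :=
  (ContinuousMultilinearMap.apply ℝ (fun _ : Fin j => E) F (fun _ => a)).hasFDerivAt.comp y
    (hh.differentiableAt_iteratedFDeriv (by exact_mod_cast Nat.lt_succ_self j)).hasFDerivAt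

theorem hasDerivAt_dirDeriv {j : ℕ} {h : E → F} {y a : E} {t : ℝ}
    (hh : ContDiffAt ℝ (j + 1) h (y + t • a)) :
    HasDerivAt (fun s : ℝ => dirDeriv j h a (y + s • a)) (dirDeriv (j + 1) h a (y + t • a)) t := by
  have hline : HasDerivAt (fun s : ℝ => y + s • a) a t := by
    simpa using ((hasDerivAt_id t).smul_const a).const_add y
  refine ((hasFDerivAt_dirDeriv hh a).comp_hasDerivAt t hline).congr_deriv ?_
  rw [dirDeriv, iteratedFDeriv_succ_apply_left]
  rfl

section Line

variable {W : Set E} {h : E → F} {p : ℕ} {y : E}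

theorem iteratedDeriv_comp_add_smul (hW : IsOpen W) (hh : ContDiffOn ℝ p h W) (y a : E) {j : ℕ}
    (hj : j ≤ p) {t : ℝ} (ht : y + t • a ∈ W) :
    iteratedDeriv j (fun s : ℝ => h (y + s • a)) t = dirDeriv j h a (y + t • a) := by
  induction j generalizing t with
  | zero => simp [dirDeriv]
  | succ j ih =>
    have hmem : {s : ℝ | y + s • a ∈ W} ∈ 𝓝 t :=
      (hW.preimage (by fun_prop : Continuous fun s : ℝ => y + s • a)).mem_nhds ht
    have heq : iteratedDeriv j (fun s : ℝ => h (y + s • a)) =ᶠ[𝓝 t]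
        fun s => dirDeriv j h a (y + s • a) := by
      filter_upwards [hmem] with s hs using ih (by omega) hs
    rw [iteratedDeriv_succ, heq.deriv_eq]
    exact (hasDerivAt_dirDeriv
      ((hh.contDiffAt (hW.mem_nhds ht)).of_le (by exact_mod_cast hj))).deriv

theorem norm_iteratedFDerivWithin_comp_add_smul (hW : IsOpen W) (hh : ContDiffOn ℝ p h W)
    (hy : y ∈ W) (a : E) {j : ℕ} (hj : j ≤ p) :
    ‖iteratedFDerivWithin ℝ j (fun s : ℝ => h (y + s • a)) {s | y + s • a ∈ W} 0‖ =
      ‖dirDeriv j h a y‖ := by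
  have hopen : IsOpen {s : ℝ | y + s • a ∈ W} :=
    hW.preimage (by fun_prop : Continuous fun s : ℝ => y + s • a)
  have hmem : y + (0 : ℝ) • a ∈ W := by simpa using hy
  rw [iteratedFDerivWithin_of_isOpen j hopen hmem, norm_iteratedFDeriv_eq_norm_iteratedDeriv,
    iteratedDeriv_comp_add_smul hW hh y a hj hmem,
    zero_smul, add_zero]

theorem norm_dirDeriv_bilinear_le (B : F →L[ℝ] G →L[ℝ] H) (hB : ‖B‖ ≤ 1) (hW : IsOpen W)
    {u : E → F} {v : E → G} (hu : ContDiffOn ℝ p u W) (hv : ContDiffOn ℝ p v W) (hy : y ∈ W)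
    (a : E) :
    ‖dirDeriv p (fun z => B (u z) (v z)) a y‖ ≤ ∑ i ∈ Finset.range (p + 1),
      (p.choose i : ℝ) * ‖dirDeriv i u a y‖ * ‖dirDeriv (p - i) v a y‖ := by
  have hline : ContDiff ℝ p fun s : ℝ => y + s • a := by fun_prop
  have hBuv : ContDiffOn ℝ p (fun z => B (u z) (v z)) W :=
    B.isBoundedBilinearMap.contDiff.comp_contDiffOn (hu.prodMk hv)
  have hleibniz := B.norm_iteratedFDerivWithin_le_of_bilinear_of_le_one
    (hu.comp hline.contDiffOn fun _ hs => hs) (hv.comp hline.contDiffOn fun _ hs => hs)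
    (hW.preimage hline.continuous).uniqueDiffOn (x := 0)
    (show y + (0 : ℝ) • a ∈ W by simpa using hy) le_rfl hB
  refine (norm_iteratedFDerivWithin_comp_add_smul hW hBuv hy a le_rfl).symm.trans_le
    (hleibniz.trans_eq (Finset.sum_congr rfl fun i hi => ?_))
  rw [← norm_iteratedFDerivWithin_comp_add_smul hW hu hy a (Finset.mem_range_succ_iff.1 hi),
    ← norm_iteratedFDerivWithin_comp_add_smul hW hv hy a (p.sub_le i)]
  rfl

end Line

/-- The bound `‖h‖_{W,p} ≤ C` on the `C^p` norm, in terms of derivatives in one direction. -/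
def CkNormLE (p : ℕ) (h : E → F) (C : ℝ) (W : Set E) : Prop :=
  ∀ z ∈ W, ∀ j ≤ p, ∀ a : E, ‖a‖ = 1 → ‖dirDeriv j h a z‖ ≤ C

theorem CkNormLE.mono {p q : ℕ} {h : E → F} {C : ℝ} {V W : Set E} (hC : CkNormLE p h C W)
    (hq : q ≤ p) (hVW : V ⊆ W) : CkNormLE q h C V :=
  fun z hz j hj => hC z (hVW hz) j (hj.trans hq)

section Variation

variable {h : E → F} {y y' a : E} {r C : ℝ} {j p : ℕ}

theorem norm_iteratedFDeriv_cons_le (hh : ContDiffAt ℝ (j + 1 : ℕ) h y) (hC0 : 0 ≤ C)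
    (hC : ∀ b : E, ‖b‖ = 1 → ‖dirDeriv (j + 1) h b y‖ ≤ C) {b : E} (hb : ‖b‖ ≤ 1) (ha : ‖a‖ ≤ 1) :
    ‖iteratedFDeriv ℝ (j + 1) h y (Fin.cons b fun _ => a)‖ ≤ polarConst (j + 1) * C :=
  norm_le_polarConst_mul _ (iteratedFDeriv_comp_perm_of_contDiffAt hh) hC0
    (norm_diagonal_le_mul_pow _ hC) (Fin.cases hb fun _ => ha)

theorem norm_dirDeriv_sub_le (hh : ContDiffOn ℝ p h (Metric.ball y r))
    (hC : CkNormLE p h C (Metric.ball y r)) (hj : j < p) (hy' : y' ∈ Metric.ball y r)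
    (ha : ‖a‖ = 1) :
    ‖dirDeriv j h a y' - dirDeriv j h a y‖ ≤ polarConst p * C * r := by
  have hC0 : 0 ≤ C := (norm_nonneg _).trans (hC y' hy' 0 (Nat.zero_le _) a ha)
  have hpos : 0 ≤ polarConst p * C := mul_nonneg (polarConst_nonneg _) hC0
  have hat : ∀ z ∈ Metric.ball y r, ContDiffAt ℝ (j + 1 : ℕ) h z := fun z hz =>
    (hh.contDiffAt (Metric.isOpen_ball.mem_nhds hz)).of_le (by exact_mod_cast hj)
  refine ((convex_ball y r).norm_image_sub_le_of_norm_hasFDerivWithin_le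
    (fun z hz => (hasFDerivAt_dirDeriv (hat z hz) a).hasFDerivWithinAt) (fun z hz =>
      ContinuousLinearMap.opNorm_le_of_unit_norm hpos fun b hb => ?_)
    (Metric.mem_ball_self (dist_nonneg.trans_lt hy')) hy').trans ?_
  · exact (norm_iteratedFDeriv_cons_le (hat z hz) hC0 (hC z hz (j + 1) hj) hb.le ha.le).trans
      (mul_le_mul_of_nonneg_right (monotone_polarConst hj) hC0)
  · rw [← dist_eq_norm]
    exact mul_le_mul_of_nonneg_left (Metric.mem_ball.1 hy').le hpos

end Variation

theorem dirDeriv_add {j : ℕ} {u v : E → F} {y : E} (hu : ContDiffAt ℝ j u y)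
    (hv : ContDiffAt ℝ j v y) (a : E) :
    dirDeriv j (fun z => u z + v z) a y = dirDeriv j u a y + dirDeriv j v a y :=
  congrArg (· fun _ => a) (iteratedFDeriv_add_apply hu hv)

theorem dirDeriv_sub {j : ℕ} {u v : E → F} {y : E} (hu : ContDiffAt ℝ j u y)
    (hv : ContDiffAt ℝ j v y) (a : E) :
    dirDeriv j (fun z => u z - v z) a y = dirDeriv j u a y - dirDeriv j v a y :=
  congrArg (· fun _ => a) (iteratedFDeriv_sub_apply hu hv)

theorem dirDeriv_clm_comp (L : F →L[ℝ] G) {j : ℕ} {u : E → F} {y : E} (hu : ContDiffAt ℝ j u y)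
    (a : E) : dirDeriv j (fun z => L (u z)) a y = L (dirDeriv j u a y) :=
  congrArg (· fun _ => a) (L.iteratedFDeriv_comp_left hu le_rfl)

end Directional

section SquaredNorm

variable {E H : Type*} [NormedAddCommGroup E] [NormedSpace ℝ E]
  [NormedAddCommGroup H] [InnerProductSpace ℝ H] {W : Set E} {φ φ' : E → H} {k : ℕ} {y : E}

theorem abs_dirDeriv_normSq_le (hW : IsOpen W) (hφ : ContDiffOn ℝ k φ W) (hy : y ∈ W) (a : E)
    {C : ℝ} (hC : ∀ j ≤ k, ‖dirDeriv j φ a y‖ ≤ C) :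
    |dirDeriv k (fun z => ‖φ z‖ ^ 2) a y| ≤ 2 ^ k * C ^ 2 := by
  have hC0 : 0 ≤ C := (norm_nonneg _).trans (hC 0 (Nat.zero_le _))
  have hinner : (fun z => ‖φ z‖ ^ 2) = fun z => innerSL ℝ (φ z) (φ z) := by
    funext z
    rw [innerSL_apply_apply, real_inner_self_eq_norm_sq]
  have hchoose : ∑ i ∈ Finset.range (k + 1), (k.choose i : ℝ) = 2 ^ k := by
    exact_mod_cast Nat.sum_range_choose k
  rw [hinner, ← Real.norm_eq_abs, ← hchoose, Finset.sum_mul]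
  refine (norm_dirDeriv_bilinear_le (innerSL ℝ) (norm_innerSL_le ℝ) hW hφ hφ hy a).trans
    (Finset.sum_le_sum fun i hi => ?_)
  rw [sq, mul_assoc]
  gcongr
  · exact hC i (Finset.mem_range_succ_iff.1 hi)
  · exact hC _ (Nat.sub_le _ _)

theorem sum_choose_mul_le {w : ℕ → ℝ} {A B : ℝ} (hA : ∀ i, 2 * i ≤ k → w i ≤ A)
    (hB : ∀ i ≤ k, w i ≤ B) :
    ∑ i ∈ Finset.range (k + 1), (k.choose i : ℝ) * w i ≤ 2 ^ k * ((A + B) / 2) := by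
  have hreflect : ∑ i ∈ Finset.range (k + 1), (k.choose i : ℝ) * w i =
      ∑ i ∈ Finset.range (k + 1), (k.choose i : ℝ) * w (k - i) := by
    rw [← Finset.sum_range_reflect]
    refine Finset.sum_congr rfl fun i hi => ?_
    rw [Finset.mem_range] at hi
    rw [show k + 1 - 1 - i = k - i by omega, Nat.choose_symm (by omega)]
  have hpairs : ∑ i ∈ Finset.range (k + 1), (k.choose i : ℝ) * (w i + w (k - i)) ≤
      ∑ i ∈ Finset.range (k + 1), (k.choose i : ℝ) * (A + B) := by
    refine Finset.sum_le_sum fun i hi => mul_le_mul_of_nonneg_left ?_ (Nat.cast_nonneg _)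
    rw [Finset.mem_range] at hi
    rcases le_total (2 * i) k with h | h
    · exact add_le_add (hA i h) (hB _ (Nat.sub_le _ _))
    · rw [add_comm]
      exact add_le_add (hA (k - i) (by omega)) (hB _ (by omega))
  have hchoose : ∑ i ∈ Finset.range (k + 1), (k.choose i : ℝ) = 2 ^ k := by
    exact_mod_cast Nat.sum_range_choose k
  simp_rw [mul_add] at hpairs
  rw [Finset.sum_add_distrib, ← hreflect] at hpairs
  simp_rw [← mul_add] at hpairs
  rw [← Finset.sum_mul, hchoose] at hpairs
  linarith

/-- The Leibniz rule for `‖φ‖² - ‖φ'‖² = ⟪φ + φ', φ - φ'⟫`, where `φ + φ' = 2φ - (φ - φ')`. The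
orders `i` and `k - i` have the same weight, so half of them benefit from the better bound `A`. -/
theorem abs_dirDeriv_normSq_sub_le (hW : IsOpen W) (hφ : ContDiffOn ℝ k φ W)
    (hφ' : ContDiffOn ℝ k φ' W) (hy : y ∈ W) (a : E) {A B δ : ℝ}
    (hA : ∀ i, 2 * i ≤ k → ‖dirDeriv i φ a y‖ ≤ A) (hB : ∀ i ≤ k, ‖dirDeriv i φ a y‖ ≤ B)
    (hδ : ∀ i ≤ k, ‖dirDeriv i (fun z => φ z - φ' z) a y‖ ≤ δ) :
    |dirDeriv k (fun z => ‖φ z‖ ^ 2) a y - dirDeriv k (fun z => ‖φ' z‖ ^ 2) a y| ≤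
      2 ^ k * (δ * (A + B + δ)) := by
  have hδ0 : 0 ≤ δ := (norm_nonneg _).trans (hδ 0 (Nat.zero_le _))
  have hat : ∀ {u : E → H}, ContDiffOn ℝ k u W → ∀ {i : ℕ}, i ≤ k → ContDiffAt ℝ i u y :=
    fun hu i hi => (hu.contDiffAt (hW.mem_nhds hy)).of_le (by exact_mod_cast hi)
  have hsq : ∀ {u : E → H}, ContDiffOn ℝ k u W → ContDiffAt ℝ k (fun z => ‖u z‖ ^ 2) y :=
    fun hu => (hu.norm_sq ℝ).contDiffAt (hW.mem_nhds hy)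
  have hinner : (fun z => ‖φ z‖ ^ 2 - ‖φ' z‖ ^ 2) =
      fun z => innerSL ℝ (φ z + φ' z) (φ z - φ' z) := by
    funext z
    rw [innerSL_apply_apply, inner_add_left, inner_sub_right, inner_sub_right,
      real_inner_self_eq_norm_sq, real_inner_self_eq_norm_sq, real_inner_comm (φ z) (φ' z)]
    ring
  have hadd : ∀ i ≤ k, ‖dirDeriv i (fun z => φ z + φ' z) a y‖ ≤ 2 * ‖dirDeriv i φ a y‖ + δ := by
    intro i hi
    have hsub := hδ i hi
    rw [dirDeriv_sub (hat hφ hi) (hat hφ' hi)] at hsub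
    rw [dirDeriv_add (hat hφ hi) (hat hφ' hi)]
    calc ‖dirDeriv i φ a y + dirDeriv i φ' a y‖
        = ‖(2 : ℝ) • dirDeriv i φ a y - (dirDeriv i φ a y - dirDeriv i φ' a y)‖ := by
          rw [two_smul]; congr 1; abel
      _ ≤ 2 * ‖dirDeriv i φ a y‖ + δ := by
          refine (norm_sub_le _ _).trans (add_le_add ?_ hsub)
          rw [norm_smul, Real.norm_two]
  rw [← dirDeriv_sub (hsq hφ) (hsq hφ'), hinner, ← Real.norm_eq_abs]
  calc _ ≤ ∑ i ∈ Finset.range (k + 1), (k.choose i : ℝ) * ((2 * ‖dirDeriv i φ a y‖ + δ) * δ) := by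
        refine (norm_dirDeriv_bilinear_le (innerSL ℝ) (norm_innerSL_le ℝ) hW (hφ.add hφ')
          (hφ.sub hφ') hy a).trans (Finset.sum_le_sum fun i hi => ?_)
        rw [mul_assoc]
        gcongr
        · exact hadd i (Finset.mem_range_succ_iff.1 hi)
        · exact hδ _ (Nat.sub_le _ _)
    _ ≤ 2 ^ k * (((2 * A + δ) * δ + (2 * B + δ) * δ) / 2) := by
        refine sum_choose_mul_le (fun i hi => ?_) fun i hi => ?_
        · gcongr
          exact hA i hi
        · gcongr
          exact hB i hi
    _ = 2 ^ k * (δ * (A + B + δ)) := by ring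

end SquaredNorm

/-! ### Directions in which sublevel sets have short sections -/

section ShortSections

variable {E : Type*} [NormedAddCommGroup E] [NormedSpace ℝ E] {y a : E} {r : ℝ}

theorem ordConnected_preimage_add_smul_ball (y z a : E) (r : ℝ) :
    ((fun t : ℝ => z + t • a) ⁻¹' Metric.ball y r).OrdConnected := by
  have hline : (fun t : ℝ => z + t • a) = AffineMap.lineMap z (z + a) := by
    funext t
    simp [AffineMap.lineMap_apply, add_comm]
  rw [hline]
  exact ((convex_ball y r).affine_preimage (AffineMap.lineMap z (z + a))).ordConnected

theorem bddBelow_preimage_add_smul_ball (y z : E) (ha : ‖a‖ = 1) (r : ℝ) :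
    BddBelow ((fun t : ℝ => z + t • a) ⁻¹' Metric.ball y r) := by
  refine ⟨-(‖y - z‖ + r), fun t ht => ?_⟩
  have hball : ‖z + t • a - y‖ < r := mem_ball_iff_norm.1 ht
  have htriangle : ‖t • a‖ ≤ ‖z + t • a - y‖ + ‖y - z‖ := by
    simpa [show z + t • a - y + (y - z) = t • a by abel] using
      norm_add_le (z + t • a - y) (y - z)
  rw [norm_smul, ha, mul_one, Real.norm_eq_abs] at htriangle
  linarith [neg_abs_le t]

theorem volume_section_le {w : E → ℝ} {k : ℕ} (hw : ContDiffOn ℝ k w (Metric.ball y r))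
    (ha : ‖a‖ = 1) {c ε h : ℝ} (hc : ∀ z ∈ Metric.ball y r, c ≤ |dirDeriv k w a z|) (hh : 0 < h)
    (hlt : 2 ^ k * ε < c * h ^ k) (z : E) :
    volume ((fun t : ℝ => z + t • a) ⁻¹' {b ∈ Metric.ball y r | |w b| ≤ ε}) ≤
      ENNReal.ofReal (k * h) := by
  refine volume_le_of_forall_abs_le_of_le_abs_deriv (ordConnected_preimage_add_smul_ball y z a r)
    (bddBelow_preimage_add_smul_ball y z ha r) (u := fun j t => dirDeriv j w a (z + t • a))
    (fun j hj t ht => hasDerivAt_dirDeriv ?_) (fun t ht => hc _ ht) hh hlt (fun t ht => ht.1)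
    fun t ht => ?_
  · exact (hw.contDiffAt (Metric.isOpen_ball.mem_nhds ht)).of_le (by exact_mod_cast hj)
  · simpa [dirDeriv] using ht.2

theorem two_mul_four_pow_le {μ : ℕ} (hμ : 0 < μ) :
    (2 : ℝ) * 4 ^ μ ≤ (4 * (1 + 1 / (μ : ℝ))) ^ μ := by
  have hinv : (0 : ℝ) ≤ 1 / μ := by positivity
  have hbernoulli : 1 + (μ : ℝ) * (1 / μ) ≤ (1 + 1 / (μ : ℝ)) ^ μ :=
    one_add_mul_le_pow (by linarith) _
  rw [mul_one_div_cancel (by positivity), one_add_one_eq_two] at hbernoulli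
  rw [mul_pow, mul_comm]
  gcongr

theorem pow_lt_mul_pow {μ i : ℕ} (hμ : 0 < μ) (hi : i ≤ μ) {c x : ℝ} (hx : 0 < x) (hx1 : x ≤ 1)
    (hxc : x < c) (hc : i = μ → 1 < c * (2 * 4 ^ μ)) :
    x ^ μ < c * (4 * (1 + 1 / (μ : ℝ)) * x) ^ i := by
  have hc0 : 0 < c := hx.trans hxc
  suffices hfactor : x ^ (μ - i) < c * (4 * (1 + 1 / (μ : ℝ))) ^ i by
    calc x ^ μ = x ^ (μ - i) * x ^ i := by rw [← pow_add, Nat.sub_add_cancel hi]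
      _ < c * (4 * (1 + 1 / (μ : ℝ))) ^ i * x ^ i := by gcongr
      _ = _ := by rw [mul_pow _ x]; ring
  rcases hi.eq_or_lt with rfl | hlt
  · rw [Nat.sub_self, pow_zero]
    exact (hc rfl).trans_le (mul_le_mul_of_nonneg_left (two_mul_four_pow_le hμ) hc0.le)
  · have hinv : (0 : ℝ) ≤ 1 / μ := by positivity
    calc x ^ (μ - i) ≤ x := pow_le_of_le_one hx.le hx1 (by omega)
      _ < c := hxc
      _ ≤ c * (4 * (1 + 1 / (μ : ℝ))) ^ i :=
        le_mul_of_one_le_right hc0.le (one_le_pow₀ (by linarith))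

theorem volume_section_le_of_le_abs_dirDeriv {w : E → ℝ} {μ k : ℕ} (hμ : 0 < μ) (hk : k ≤ μ)
    (hw : ContDiffOn ℝ k w (Metric.ball y r)) (ha : ‖a‖ = 1) {β x : ℝ} (hβ : 0 < β) (hx : 0 < x)
    (hx' : x ≤ 1 / 640) (hc : ∀ z ∈ Metric.ball y r, 0.127 * β ≤ |dirDeriv k w a z|) (z : E) :
    volume ((fun t : ℝ => z + t • a) ⁻¹' {b ∈ Metric.ball y r | |w b| ≤ x ^ μ * β}) ≤
      ENNReal.ofReal (8 * (μ + 1) * x) := by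
  have hμ' : (0 : ℝ) < μ := by exact_mod_cast hμ
  have hpow : (4 : ℝ) ^ 1 ≤ 4 ^ μ := pow_le_pow_right₀ (by norm_num) hμ
  have hlt := pow_lt_mul_pow hμ hk (c := 0.127) hx (by linarith) (by linarith)
    fun _ => by linarith
  refine (volume_section_le hw ha hc (h := 2 * (4 * (1 + 1 / (μ : ℝ)) * x)) (by positivity) ?_
    z).trans (ENNReal.ofReal_le_ofReal ?_)
  · calc 2 ^ k * (x ^ μ * β) < 2 ^ k * (0.127 * (4 * (1 + 1 / (μ : ℝ)) * x) ^ k * β) := by gcongr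
      _ = _ := by rw [mul_pow 2]; ring
  · calc (k : ℝ) * (2 * (4 * (1 + 1 / (μ : ℝ)) * x))
        ≤ μ * (2 * (4 * (1 + 1 / (μ : ℝ)) * x)) := by gcongr
      _ = 8 * (μ + 1) * x := by field_simp; ring

theorem volume_section_sq_le_of_le_abs_dirDeriv {w : E → ℝ} {μ j : ℕ} (hμ : 0 < μ)
    (hj : 2 * j ≤ μ) (hw : ContDiffOn ℝ j w (Metric.ball y r)) (ha : ‖a‖ = 1) {β x F : ℝ}
    (hx : 0 < x) (hx' : x ≤ 1 / 640) (hF0 : 0 < F) (hβ : 0 < β) (hβF : β ≤ 2 ^ μ * F ^ 2)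
    (hc : ∀ z ∈ Metric.ball y r, 0.178 * F ≤ |dirDeriv j w a z|) (z : E) :
    volume ((fun t : ℝ => z + t • a) ⁻¹' {b ∈ Metric.ball y r | |w b| ^ 2 ≤ x ^ μ * β}) ≤
      ENNReal.ofReal (8 * (μ + 1) * x) := by
  have hμ' : (0 : ℝ) < μ := by exact_mod_cast hμ
  have hj' : 2 * (j : ℝ) ≤ μ := by exact_mod_cast hj
  have hpow : 2 * j = μ → (4 : ℝ) ^ 2 ≤ 4 ^ μ := fun h =>
    pow_le_pow_right₀ (by norm_num) (by omega)
  have hlt := pow_lt_mul_pow hμ hj (c := 0.178 ^ 2) (x := 2 * x) (by positivity) (by linarith)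
    (by linarith) fun h => by linarith [hpow h]
  have hsq : (2 ^ j * √(x ^ μ * β)) ^ 2 <
      (0.178 * F * (2 * (4 * (1 + 1 / (μ : ℝ)) * (2 * x))) ^ j) ^ 2 := by
    calc (2 ^ j * √(x ^ μ * β)) ^ 2 = (2 ^ j) ^ 2 * (x ^ μ * β) := by
          rw [mul_pow, Real.sq_sqrt (by positivity)]
      _ ≤ (2 ^ j) ^ 2 * (x ^ μ * (2 ^ μ * F ^ 2)) := by gcongr
      _ = (2 ^ j) ^ 2 * ((2 * x) ^ μ * F ^ 2) := by ring
      _ < (2 ^ j) ^ 2 * (0.178 ^ 2 * (4 * (1 + 1 / (μ : ℝ)) * (2 * x)) ^ (2 * j) * F ^ 2) := by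
          gcongr
      _ = _ := by rw [mul_pow 2 _ j, mul_comm 2 j, pow_mul]; ring
  have hsub : {b ∈ Metric.ball y r | |w b| ^ 2 ≤ x ^ μ * β} ⊆
      {b ∈ Metric.ball y r | |w b| ≤ √(x ^ μ * β)} :=
    fun _ hb => ⟨hb.1, Real.le_sqrt_of_sq_le hb.2⟩
  refine (measure_mono (Set.preimage_mono hsub)).trans ((volume_section_le hw ha hc (by positivity)
    (lt_of_pow_lt_pow_left₀ 2 (by positivity) hsq) z).trans (ENNReal.ofReal_le_ofReal ?_))
  calc (j : ℝ) * (2 * (4 * (1 + 1 / (μ : ℝ)) * (2 * x)))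
      = 2 * j * (8 * (1 + 1 / (μ : ℝ)) * x) := by ring
    _ ≤ μ * (8 * (1 + 1 / (μ : ℝ)) * x) := by gcongr
    _ = 8 * (μ + 1) * x := by field_simp

end ShortSections

section Perturbation

variable {E H : Type*} [NormedAddCommGroup E] [NormedSpace ℝ E]
  [NormedAddCommGroup H] [InnerProductSpace ℝ H] {φ φ' : E → H} {μ : ℕ} {y a : E}
  {r β F δ G x : ℝ}

theorem le_abs_dirDeriv_clm_comp {j : ℕ} (hj : j ≤ μ)
    (hφ : ContDiffOn ℝ j φ (Metric.ball y r)) (hφ' : ContDiffOn ℝ j φ' (Metric.ball y r))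
    (hδ : CkNormLE μ (fun z => φ z - φ' z) δ (Metric.ball y r)) (ha : ‖a‖ = 1) {η : ℝ}
    (hmove : ∀ z ∈ Metric.ball y r, ‖dirDeriv j φ a z - dirDeriv j φ a y‖ ≤ η)
    {L : H →L[ℝ] ℝ} (hL : ‖L‖ ≤ 1) (hLy : L (dirDeriv j φ a y) = ‖dirDeriv j φ a y‖) {z : E}
    (hz : z ∈ Metric.ball y r) :
    ‖dirDeriv j φ a y‖ - η - δ ≤ |dirDeriv j (fun z => L (φ' z)) a z| := by
  have hLle : ∀ v, |L v| ≤ ‖v‖ := fun v => by simpa using L.le_of_opNorm_le hL v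
  have hφz := hφ.contDiffAt (Metric.isOpen_ball.mem_nhds hz)
  have hφ'z := hφ'.contDiffAt (Metric.isOpen_ball.mem_nhds hz)
  have hclose := (hLle _).trans (hδ z hz j hj a ha)
  have hnear := (hLle _).trans (hmove z hz)
  rw [dirDeriv_sub hφz hφ'z, map_sub] at hclose
  rw [map_sub, hLy] at hnear
  rw [dirDeriv_clm_comp L hφ'z]
  linarith [le_abs_self (L (dirDeriv j φ' a z)), (abs_le.1 hclose).2, (abs_le.1 hnear).1]

/-- Testing `φ'` against a norming functional of `D^j φ(y)(a, …, a)` reduces to real-valued maps. -/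
theorem volume_section_le_of_lt_norm_dirDeriv {j : ℕ} (hμ : 0 < μ) (hj : 2 * j ≤ μ)
    (hφ : ContDiffOn ℝ j φ (Metric.ball y r)) (hφ' : ContDiffOn ℝ j φ' (Metric.ball y r))
    (hδ : CkNormLE μ (fun z => φ z - φ' z) δ (Metric.ball y r)) (ha : ‖a‖ = 1)
    (hmove : ∀ z ∈ Metric.ball y r, ‖dirDeriv j φ a z - dirDeriv j φ a y‖ ≤ 0.05 * F)
    (hlarge : 0.595 * F < ‖dirDeriv j φ a y‖) (hF : 0 < F) (hβ : 0 < β)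
    (hβF : β ≤ 2 ^ μ * F ^ 2) (hδF : 2 ^ μ * (δ * (F + δ)) ≤ β / 2) (hx : 0 < x)
    (hx' : x ≤ 1 / 640) (z : E) :
    volume ((fun t : ℝ => z + t • a) ⁻¹' {b ∈ Metric.ball y r | ‖φ' b‖ ^ 2 ≤ x ^ μ * β}) ≤
      ENNReal.ofReal (8 * (μ + 1) * x) := by
  obtain ⟨L, hL, hLy⟩ := exists_dual_vector'' ℝ (dirDeriv j φ a y)
  have hδ' : δ ≤ 0.367 * F := by
    by_contra! hlt
    have hcontra : 2 ^ μ * (0.501 * F ^ 2) ≤ 2 ^ μ * (δ * (F + δ)) := by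
      refine mul_le_mul_of_nonneg_left ?_ (by positivity)
      nlinarith
    have hpos : (0 : ℝ) < 2 ^ μ * F ^ 2 := by positivity
    linarith
  have hc : ∀ z ∈ Metric.ball y r, 0.178 * F ≤ |dirDeriv j (fun z => L (φ' z)) a z| := by
    intro z hz
    linarith [le_abs_dirDeriv_clm_comp (by omega) hφ hφ' hδ ha hmove hL hLy hz]
  have hsub : {b ∈ Metric.ball y r | ‖φ' b‖ ^ 2 ≤ x ^ μ * β} ⊆
      {b ∈ Metric.ball y r | |L (φ' b)| ^ 2 ≤ x ^ μ * β} := by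
    refine fun b hb => ⟨hb.1, le_trans ?_ hb.2⟩
    gcongr
    simpa using L.le_of_opNorm_le hL (φ' b)
  exact (measure_mono (Set.preimage_mono hsub)).trans (volume_section_sq_le_of_le_abs_dirDeriv hμ
    hj (L.contDiff.comp_contDiffOn hφ') ha hx hx' hF hβ hβF hc z)

theorem le_abs_dirDeriv_normSq {k : ℕ} (hk : k ≤ μ) (hφ : ContDiffOn ℝ k φ (Metric.ball y r))
    (hφ' : ContDiffOn ℝ k φ' (Metric.ball y r)) (hF : CkNormLE μ φ F (Metric.ball y r))
    (hδ : CkNormLE μ (fun z => φ z - φ' z) δ (Metric.ball y r)) (ha : ‖a‖ = 1)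
    (hmove : ∀ z ∈ Metric.ball y r,
      |dirDeriv k (fun z => ‖φ z‖ ^ 2) a z - dirDeriv k (fun z => ‖φ z‖ ^ 2) a y| ≤ β / 20)
    (hsmall : ∀ z ∈ Metric.ball y r, ∀ i, 2 * i ≤ k → ‖dirDeriv i φ a z‖ ≤ 0.645 * F)
    (hδF : 2 ^ μ * (δ * (F + δ)) ≤ β / 2)
    (hy : β ≤ |dirDeriv k (fun z => ‖φ z‖ ^ 2) a y|) {z : E} (hz : z ∈ Metric.ball y r) :
    0.127 * β ≤ |dirDeriv k (fun z => ‖φ' z‖ ^ 2) a z| := by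
  have hF0 : 0 ≤ F := (norm_nonneg _).trans (hF z hz 0 (Nat.zero_le _) a ha)
  have hδ0 : 0 ≤ δ := (norm_nonneg _).trans (hδ z hz 0 (Nat.zero_le _) a ha)
  have hclose := abs_dirDeriv_normSq_sub_le Metric.isOpen_ball hφ hφ' hz a (hsmall z hz)
    (fun i hi => hF z hz i (hi.trans hk) a ha) fun i hi => hδ z hz i (hi.trans hk) a ha
  have hpert : 2 ^ k * (δ * (0.645 * F + F + δ)) ≤ 1.645 * (2 ^ μ * (δ * (F + δ))) := by
    calc 2 ^ k * (δ * (0.645 * F + F + δ)) ≤ 2 ^ μ * (δ * (1.645 * (F + δ))) := by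
          gcongr
          · norm_num
          · linarith
      _ = _ := by ring
  have hβ : 0 ≤ β := by linarith [abs_nonneg (dirDeriv k (fun z => ‖φ z‖ ^ 2) a z
    - dirDeriv k (fun z => ‖φ z‖ ^ 2) a y), hmove z hz]
  have hnear := hmove z hz
  rw [abs_sub_comm] at hnear
  linarith [abs_sub_abs_le_abs_sub (dirDeriv k (fun z => ‖φ z‖ ^ 2) a y)
    (dirDeriv k (fun z => ‖φ z‖ ^ 2) a z), abs_sub_abs_le_abs_sub
    (dirDeriv k (fun z => ‖φ z‖ ^ 2) a z) (dirDeriv k (fun z => ‖φ' z‖ ^ 2) a z)]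

/-- Either some derivative of `φ` of order at most `μ / 2` in the direction `a` is comparable with
`F` at `y`, and then `φ'` itself has a large derivative, or the terms of the Leibniz formula for
`‖φ‖² - ‖φ'‖²` are small enough for `‖φ'‖²` to inherit the large derivative of `‖φ‖²`. -/
theorem volume_section_normSq_le {k : ℕ} (hμ : 0 < μ) (hk : k ≤ μ)
    (hφ : ContDiffOn ℝ μ φ (Metric.ball y r)) (hφ' : ContDiffOn ℝ μ φ' (Metric.ball y r))
    (hF : CkNormLE μ φ F (Metric.ball y r))
    (hδ : CkNormLE μ (fun z => φ z - φ' z) δ (Metric.ball y r)) (ha : ‖a‖ = 1) (hr : 0 < r)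
    (hmoveφ : ∀ j < μ, ∀ z ∈ Metric.ball y r,
      ‖dirDeriv j φ a z - dirDeriv j φ a y‖ ≤ 0.05 * F)
    (hmove : ∀ z ∈ Metric.ball y r,
      |dirDeriv k (fun z => ‖φ z‖ ^ 2) a z - dirDeriv k (fun z => ‖φ z‖ ^ 2) a y| ≤ β / 20)
    (hβ : 0 < β) (hδF : 2 ^ μ * (δ * (F + δ)) ≤ β / 2)
    (hy : β ≤ |dirDeriv k (fun z => ‖φ z‖ ^ 2) a y|) (hx : 0 < x) (hx' : x ≤ 1 / 640) (z : E) :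
    volume ((fun t : ℝ => z + t • a) ⁻¹' {b ∈ Metric.ball y r | ‖φ' b‖ ^ 2 ≤ x ^ μ * β}) ≤
      ENNReal.ofReal (8 * (μ + 1) * x) := by
  have hyr : y ∈ Metric.ball y r := Metric.mem_ball_self hr
  have hsmooth : ∀ {u : E → H}, ContDiffOn ℝ μ u (Metric.ball y r) → ∀ m ≤ μ,
      ContDiffOn ℝ m u (Metric.ball y r) := fun hu m hm => hu.of_le (by exact_mod_cast hm)
  have hβF : β ≤ 2 ^ μ * F ^ 2 := by
    refine hy.trans ((abs_dirDeriv_normSq_le Metric.isOpen_ball (hsmooth hφ k hk) hyr a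
      fun j hj => hF y hyr j (hj.trans hk) a ha).trans ?_)
    gcongr
    norm_num
  by_cases hlarge : ∃ j, 2 * j ≤ μ ∧ 0.595 * F < ‖dirDeriv j φ a y‖
  · obtain ⟨j, hj, hjF⟩ := hlarge
    have hF' : 0 < F := by
      refine ((norm_nonneg _).trans (hF y hyr 0 (Nat.zero_le _) a ha)).lt_of_ne fun h => ?_
      rw [← h, zero_pow two_ne_zero, mul_zero] at hβF
      exact hβ.not_ge hβF
    exact volume_section_le_of_lt_norm_dirDeriv hμ hj (hsmooth hφ j (by omega))
      (hsmooth hφ' j (by omega)) hδ ha (hmoveφ j (by omega)) hjF hF' hβ hβF hδF hx hx' z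
  · push Not at hlarge
    have hsmall : ∀ z ∈ Metric.ball y r, ∀ i, 2 * i ≤ k → ‖dirDeriv i φ a z‖ ≤ 0.645 * F :=
      fun z hz i hi => by
        linarith [norm_sub_norm_le (dirDeriv i φ a z) (dirDeriv i φ a y),
          hmoveφ i (by omega) z hz, hlarge i (hi.trans hk)]
    have hsection := volume_section_le_of_le_abs_dirDeriv hμ hk ((hsmooth hφ' k hk).norm_sq ℝ) ha hβ
      hx hx' (fun z hz => le_abs_dirDeriv_normSq hk (hsmooth hφ k hk) (hsmooth hφ' k hk) hF hδ ha
        hmove hsmall hδF hy hz) z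
    simpa only [abs_pow, abs_norm] using hsection

theorem exists_direction_volume_section_le (hμ : 0 < μ)
    (hφ : ContDiffOn ℝ (μ + 1 : ℕ) φ (Metric.ball y r))
    (hφ' : ContDiffOn ℝ μ φ' (Metric.ball y r)) (hF : CkNormLE μ φ F (Metric.ball y r))
    (hδ : CkNormLE μ (fun z => φ z - φ' z) δ (Metric.ball y r))
    (hG : CkNormLE (μ + 1) (fun z => ‖φ z‖ ^ 2) G (Metric.ball y r)) (hβ : 0 < β)
    (hδF : δ * (F + δ) ≤ β / 2 ^ (μ + 1)) (hβG : β ≤ G) (hr : 0 < r)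
    (hrG : r * (polarConst (μ + 1) * G) ≤ β / 20)
    (hy : ∃ k ≤ μ, ∃ a : E, ‖a‖ = 1 ∧ β ≤ |dirDeriv k (fun z => ‖φ z‖ ^ 2) a y|)
    (hx : 0 < x) (hxr : 8 * (μ + 1) * x < r) :
    ∃ a : E, ‖a‖ = 1 ∧ ∀ z : E,
      volume ((fun t : ℝ => z + t • a) ⁻¹' {b ∈ Metric.ball y r | ‖φ' b‖ ^ 2 ≤ x ^ μ * β}) ≤
        ENNReal.ofReal (8 * (μ + 1) * x) := by
  obtain ⟨k, hk, a, ha, hka⟩ := hy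
  have hμ1 : (1 : ℝ) ≤ μ := by exact_mod_cast hμ
  have hP2 : 2 ≤ polarConst (μ + 1) := two_le_polarConst (by omega)
  have hrP : r * polarConst (μ + 1) ≤ 1 / 20 :=
    le_of_mul_le_mul_right (by linarith) (hβ.trans_le hβG)
  have hF0 : 0 ≤ F :=
    (norm_nonneg _).trans (hF y (Metric.mem_ball_self hr) 0 (Nat.zero_le _) a ha)
  have hφμ : ContDiffOn ℝ μ φ (Metric.ball y r) := hφ.of_le (by exact_mod_cast μ.le_succ)
  have hδF' : 2 ^ μ * (δ * (F + δ)) ≤ β / 2 := by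
    rw [pow_succ, le_div_iff₀ (by positivity)] at hδF
    linarith
  refine ⟨a, ha, volume_section_normSq_le hμ hk hφμ hφ' hF hδ ha hr (fun j hj z hz => ?_)
    (fun z hz => ?_) hβ hδF' hka hx (by nlinarith)⟩
  · calc _ ≤ polarConst μ * F * r := norm_dirDeriv_sub_le hφμ hF hj hz ha
      _ ≤ polarConst (μ + 1) * F * r := by gcongr; exact monotone_polarConst μ.le_succ
      _ ≤ 0.05 * F := by nlinarith
  · exact (norm_dirDeriv_sub_le (hφ.norm_sq ℝ) hG (by omega) hz ha).trans (by linarith)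

end Perturbation

/-! ### Volume from short sections -/

section Volume

variable {V : Type*} [NormedAddCommGroup V] [InnerProductSpace ℝ V] [FiniteDimensional ℝ V]
  [MeasurableSpace V] [BorelSpace V] {m : ℕ}

theorem exists_measurePreserving_slicing (hm : Module.finrank ℝ V = m + 1) {a : V}
    (ha : ‖a‖ = 1) :
    ∃ (Ψ : ℝ × EuclideanSpace ℝ (Fin m) → V) (P : V → EuclideanSpace ℝ (Fin m)),
      MeasurePreserving Ψ volume volume ∧ LipschitzWith 1 P ∧ (∀ t z, P (Ψ (t, z)) = z) ∧
        ∀ t z, Ψ (t, z) = Ψ (0, z) + t • a := by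
  have hortho : Orthonormal ℝ (({0} : Set (Fin (m + 1))).domRestrict fun _ => a) :=
    ⟨fun _ => ha, fun i j hij => (hij (Subsingleton.elim i j)).elim⟩
  obtain ⟨b, hb⟩ := hortho.exists_orthonormalBasis_extension_of_card_eq (by simpa using hm)
  have hb0 : b 0 = a := hb 0 rfl
  let Ψ : ℝ × EuclideanSpace ℝ (Fin m) → V := fun p => b.repr.symm (WithLp.toLp 2
    ((MeasurableEquiv.piFinSuccAbove (fun _ : Fin (m + 1) => ℝ) 0).symm (p.1, WithLp.ofLp p.2)))
  have hΨ0 : ∀ t z, b.repr (Ψ (t, z)) 0 = t := fun t z => by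
    simp [Ψ, MeasurableEquiv.piFinSuccAbove]
  have hΨsucc : ∀ t z i, b.repr (Ψ (t, z)) (Fin.succ i) = z i := fun t z i => by
    simp [Ψ, MeasurableEquiv.piFinSuccAbove]
  refine ⟨Ψ, fun v => WithLp.toLp 2 fun i => b.repr v (Fin.succ i), ?_, ?_, fun t z => ?_,
    fun t z => b.repr.injective ?_⟩
  · exact b.measurePreserving_repr_symm.comp ((PiLp.volume_preserving_toLp (Fin (m + 1))).comp
      ((volume_preserving_piFinSuccAbove (fun _ : Fin (m + 1) => ℝ) 0).symm.comp
        ((MeasurePreserving.id volume).prod (PiLp.volume_preserving_ofLp (Fin m)))))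
  · refine LipschitzWith.mk_one fun v w => ?_
    rw [← b.repr.dist_map v w, EuclideanSpace.dist_eq, EuclideanSpace.dist_eq,
      Fin.sum_univ_succ (f := fun i => dist (b.repr v i) (b.repr w i) ^ 2)]
    exact Real.sqrt_le_sqrt (le_add_of_nonneg_left (sq_nonneg _))
  · ext i
    exact hΨsucc t z i
  · ext i
    refine Fin.cases ?_ (fun i => ?_) i
    · simp [hΨ0, ← hb0]
    · simp [hΨsucc, ← hb0, b.repr_self]

theorem volume_le_of_volume_sections_le (hm : Module.finrank ℝ V = m + 1) {a : V} (ha : ‖a‖ = 1)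
    {A : Set V} (hA : MeasurableSet A) {x₀ : V} {ρ : ℝ} (hAb : A ⊆ Metric.ball x₀ ρ) {L : ℝ≥0∞}
    (hL : ∀ z : V, volume ((fun t : ℝ => z + t • a) ⁻¹' A) ≤ L) :
    volume A ≤ L * volume (Metric.ball (0 : EuclideanSpace ℝ (Fin m)) ρ) := by
  obtain ⟨Ψ, P, hΨ, hP, hPΨ, hline⟩ := exists_measurePreserving_slicing hm ha
  have hsection : ∀ z, volume ((fun t => (t, z)) ⁻¹' (Ψ ⁻¹' A)) ≤
      (Metric.ball (P x₀) ρ).indicator (fun _ => L) z := by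
    intro z
    by_cases hz : z ∈ Metric.ball (P x₀) ρ
    · rw [Set.indicator_of_mem hz]
      convert hL (Ψ (0, z)) using 2
      ext t
      simp only [Set.mem_preimage, hline t z]
    · have hempty : (fun t => (t, z)) ⁻¹' (Ψ ⁻¹' A) = ∅ := by
        refine Set.eq_empty_of_forall_notMem fun t ht => hz (Metric.mem_ball.2 ?_)
        rw [← hPΨ t z]
        exact (hP.dist_le_mul _ _).trans_lt (by simpa using Metric.mem_ball.1 (hAb ht))
      rw [hempty, measure_empty]
      exact zero_le
  rw [← hΨ.measure_preimage hA.nullMeasurableSet, Measure.volume_eq_prod,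
    Measure.prod_apply_symm (hΨ.measurable hA), ← Measure.addHaar_ball_center volume (P x₀),
    ← lintegral_indicator_const measurableSet_ball]
  exact lintegral_mono hsection

theorem volume_ball_codim_one_le (hm : 3 ≤ m) (hV : Module.finrank ℝ V = m + 1) {ρ : ℝ}
    (hρ : 0 < ρ) : volume (Metric.ball (0 : EuclideanSpace ℝ (Fin m)) ρ) ≤
      ENNReal.ofReal ((m + 1) / (2 * ρ)) * volume (Metric.ball (0 : V) ρ) := by
  have hm' : (3 : ℝ) ≤ m := by exact_mod_cast hm
  have : Nonempty (Fin m) := ⟨⟨0, by omega⟩⟩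
  have : Nontrivial V := Module.nontrivial_of_finrank_pos (R := ℝ) (by omega)
  rw [EuclideanSpace.volume_ball, InnerProductSpace.volume_ball, hV, Fintype.card_fin,
    ← ENNReal.ofReal_pow hρ.le, ← ENNReal.ofReal_pow hρ.le, ← ENNReal.ofReal_mul (by positivity),
    ← ENNReal.ofReal_mul (by positivity), ← ENNReal.ofReal_mul (by positivity)]
  refine ENNReal.ofReal_le_ofReal ?_
  have hΓ : Real.Gamma ((m + 1) / 2) ≤ Real.Gamma (m / 2 + 1) :=
    Real.Gamma_strictMonoOn_Ici.monotoneOn (Set.mem_Ici.2 (by linarith))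
      (Set.mem_Ici.2 (by linarith)) (by linarith)
  have hΓ0 : 0 < Real.Gamma ((m + 1) / 2) := Real.Gamma_pos_of_pos (by linarith)
  have hpi : 1 ≤ √Real.pi := Real.one_le_sqrt.2 (by linarith [Real.pi_gt_three])
  rw [Nat.cast_succ, Real.Gamma_add_one (s := (m + 1) / 2) (by positivity)]
  calc ρ ^ m * (√Real.pi ^ m / Real.Gamma (m / 2 + 1))
      ≤ ρ ^ m * (√Real.pi ^ (m + 1) / Real.Gamma ((m + 1) / 2)) := by
        gcongr
        omega
    _ = _ := by
        field_simp
        ring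

theorem volume_le_diam_pow {s : Set V} (hs : Bornology.IsBounded s) :
    volume s ≤ ENNReal.ofReal (Metric.diam s ^ Module.finrank ℝ V) := by
  let coords : V → Fin (Module.finrank ℝ V) → ℝ :=
    fun v => WithLp.ofLp ((stdOrthonormalBasis ℝ V).repr v)
  have hvolume : MeasurePreserving coords volume volume :=
    (PiLp.volume_preserving_ofLp _).comp (stdOrthonormalBasis ℝ V).measurePreserving_repr
  have hlip : LipschitzWith 1 coords :=
    ((PiLp.lipschitzWith_ofLp 2 fun _ => ℝ).comp
      (stdOrthonormalBasis ℝ V).repr.lipschitz).weaken (by simp)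
  have hdiam : Metric.ediam (coords '' s) ≤ ENNReal.ofReal (Metric.diam s) := by
    rw [Metric.diam, ENNReal.ofReal_toReal hs.ediam_ne_top]
    simpa using hlip.ediam_image_le s
  calc volume s ≤ volume (coords ⁻¹' closure (coords '' s)) :=
        measure_mono fun v hv => subset_closure ⟨v, hv, rfl⟩
    _ = volume (closure (coords '' s)) :=
        hvolume.measure_preimage isClosed_closure.measurableSet.nullMeasurableSet
    _ ≤ Metric.ediam (closure (coords '' s)) ^ Module.finrank ℝ V := by
        simpa using Real.volume_pi_le_diam_pow (closure (coords '' s))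
    _ ≤ ENNReal.ofReal (Metric.diam s) ^ Module.finrank ℝ V := by
        rw [Metric.ediam_closure]
        gcongr
    _ = _ := (ENNReal.ofReal_pow Metric.diam_nonneg _).symm

theorem lintegral_volume_inter_ball {A : Set V} (hA : MeasurableSet A) (ρ : ℝ) :
    ∫⁻ x : V, volume (A ∩ Metric.ball x ρ) = volume A * volume (Metric.ball (0 : V) ρ) := by
  let S : Set (V × V) := {p | p.2 ∈ A ∧ dist p.2 p.1 < ρ}
  have hS : MeasurableSet S := (measurable_snd hA).inter
    (isOpen_lt (continuous_snd.dist continuous_fst) continuous_const).measurableSet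
  have hsection : ∀ y, volume ((fun x => (x, y)) ⁻¹' S) =
      A.indicator (fun _ => volume (Metric.ball (0 : V) ρ)) y := by
    intro y
    by_cases hy : y ∈ A
    · rw [Set.indicator_of_mem hy, ← Measure.addHaar_ball_center volume y]
      congr 1
      ext x
      simp [S, hy, dist_comm]
    · have hempty : (fun x => (x, y)) ⁻¹' S = ∅ := by ext x; simp [S, hy]
      rw [Set.indicator_of_notMem hy, hempty, measure_empty]
  calc ∫⁻ x : V, volume (A ∩ Metric.ball x ρ) = (volume.prod volume) S :=
        (Measure.prod_apply hS).symm
    _ = volume A * volume (Metric.ball (0 : V) ρ) := by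
        simp_rw [Measure.prod_apply_symm hS, hsection]
        rw [lintegral_indicator_const hA, mul_comm]

/-- By Fubini, the volume of `A` is the average over `x₀` of the volumes of `A ∩ ball x₀ ρ`, divided
by the volume of the ball; the local volumes are bounded slice by slice. -/
theorem volume_le_of_local_volume_sections_le (hm : 3 ≤ m) (hV : Module.finrank ℝ V = m + 1)
    {A K : Set V} (hA : MeasurableSet A) (hAK : A ⊆ K) (hK : Bornology.IsBounded K) {ρ L : ℝ}
    (hρ : 0 < ρ)
    (hL : ∀ x₀ : V, (A ∩ Metric.ball x₀ ρ).Nonempty → ∃ a : V, ‖a‖ = 1 ∧ ∀ z : V,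
      volume ((fun t : ℝ => z + t • a) ⁻¹' (A ∩ Metric.ball x₀ ρ)) ≤ ENNReal.ofReal L) :
    volume A ≤
      ENNReal.ofReal ((Metric.diam K + 2 * ρ) ^ (m + 1) * ((m + 1) / (2 * ρ)) * L) := by
  set B := volume (Metric.ball (0 : V) ρ)
  have hlocal : ∀ x, volume (A ∩ Metric.ball x ρ) ≤ (Metric.thickening ρ K).indicator
      (fun _ => ENNReal.ofReal L * (ENNReal.ofReal ((m + 1) / (2 * ρ)) * B)) x := by
    intro x
    rcases (A ∩ Metric.ball x ρ).eq_empty_or_nonempty with hempty | hne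
    · rw [hempty, measure_empty]
      exact zero_le
    · obtain ⟨y, hyA, hyx⟩ := hne
      rw [Set.indicator_of_mem (Metric.mem_thickening_iff.2 ⟨y, hAK hyA, Metric.mem_ball'.1 hyx⟩)]
      obtain ⟨a, ha, hsection⟩ := hL x ⟨y, hyA, hyx⟩
      refine (volume_le_of_volume_sections_le hV ha (hA.inter measurableSet_ball)
        Set.inter_subset_right hsection).trans ?_
      gcongr
      exact volume_ball_codim_one_le hm hV hρ
  have hthick : volume (Metric.thickening ρ K) ≤
      ENNReal.ofReal ((Metric.diam K + 2 * ρ) ^ (m + 1)) := by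
    refine (volume_le_diam_pow hK.thickening).trans (ENNReal.ofReal_le_ofReal ?_)
    rw [hV]
    exact pow_le_pow_left₀ Metric.diam_nonneg (Metric.diam_thickening_le _ hρ.le) _
  have hB0 : B ≠ 0 := (Metric.measure_ball_pos volume 0 hρ).ne'
  have hBtop : B ≠ ⊤ := measure_ball_lt_top.ne
  refine (ENNReal.mul_le_mul_iff_left hB0 hBtop).1 ?_
  have hdiam : 0 ≤ Metric.diam K := Metric.diam_nonneg
  calc volume A * B = ∫⁻ x : V, volume (A ∩ Metric.ball x ρ) :=
        (lintegral_volume_inter_ball hA ρ).symm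
    _ ≤ ENNReal.ofReal L * (ENNReal.ofReal ((m + 1) / (2 * ρ)) * B) *
          volume (Metric.thickening ρ K) := by
        rw [← lintegral_indicator_const Metric.isOpen_thickening.measurableSet]
        exact lintegral_mono hlocal
    _ ≤ ENNReal.ofReal L * (ENNReal.ofReal ((m + 1) / (2 * ρ)) * B) *
          ENNReal.ofReal ((Metric.diam K + 2 * ρ) ^ (m + 1)) := by gcongr
    _ = ENNReal.ofReal ((Metric.diam K + 2 * ρ) ^ (m + 1) * ((m + 1) / (2 * ρ)) * L) * B := by
        rw [ENNReal.ofReal_mul (by positivity), ENNReal.ofReal_mul (by positivity)]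
        ring

end Volume

/-! ### Volume of sublevel sets of perturbed maps -/

section MeasureEstimate

theorem sq_mul_pow_le_seventeen_pow {n : ℕ} (hn : 2 ≤ n) :
    80 * (n : ℝ) ^ 2 * (25 / 16) ^ n ≤ 3 * 17 ^ n := by
  induction n, hn using Nat.le_induction with
  | base => norm_num
  | succ n hn ih =>
    have hn' : (2 : ℝ) ≤ n := by exact_mod_cast hn
    have hsq : ((n + 1 : ℕ) : ℝ) ^ 2 ≤ 4 * (n : ℝ) ^ 2 := by push_cast; nlinarith
    calc 80 * ((n + 1 : ℕ) : ℝ) ^ 2 * (25 / 16) ^ (n + 1)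
        ≤ 80 * (4 * (n : ℝ) ^ 2) * (25 / 16) ^ (n + 1) := by gcongr
      _ = 80 * (n : ℝ) ^ 2 * (25 / 16) ^ n * (25 / 4) := by ring
      _ ≤ 3 * 17 ^ n * 17 := by gcongr; norm_num
      _ = _ := by ring

theorem sq_mul_pow_le_two_pi_exp_pow {n : ℕ} (hn : 2 ≤ n) :
    80 * (n : ℝ) ^ 2 * (25 / 16) ^ n ≤ 3 * (2 * Real.pi * Real.exp 1) ^ n := by
  refine (sq_mul_pow_le_seventeen_pow hn).trans ?_
  gcongr
  nlinarith [Real.pi_gt_d2, Real.exp_one_gt_d9]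

theorem mul_diam_div_radius_le {n : ℕ} (hn : 2 ≤ n) {d ϑ Q : ℝ} (hd : 0 < d) (hϑ : 0 < ϑ)
    (hQ : 1 ≤ Q) :
    16 * (n : ℝ) * (25 / 16) ^ n * (d / min (d / 4) (min ϑ (1 / (20 * Q)))) ≤
      3 * (2 * Real.pi * Real.exp 1) ^ n * Q * (1 / √(2 * (n : ℝ)) + 2 * d + d / ϑ) := by
  have hn' : (2 : ℝ) ≤ n := by exact_mod_cast hn
  have hconst := sq_mul_pow_le_two_pi_exp_pow hn
  set X := 3 * (2 * Real.pi * Real.exp 1) ^ n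
  set Y : ℝ := (25 / 16) ^ n
  have hY : 0 < Y := by positivity
  have hX : 0 ≤ X := by positivity
  have hnY : 0 < n * Y := by positivity
  have hXn : 160 * n * Y ≤ X := by nlinarith
  have hsqrt : 80 * n * Y ≤ X * (1 / √(2 * (n : ℝ))) := by
    rw [mul_one_div, le_div_iff₀ (by positivity)]
    have hle : √(2 * (n : ℝ)) ≤ n := Real.sqrt_le_iff.2 ⟨by linarith, by nlinarith⟩
    calc 80 * n * Y * √(2 * (n : ℝ)) ≤ 80 * n * Y * n := by gcongr
      _ ≤ X := by linarith
  have hinv : (0 : ℝ) ≤ 1 / √(2 * (n : ℝ)) := by positivity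
  have hdϑ : 0 ≤ d / ϑ := by positivity
  have hXQ : X ≤ X * Q := le_mul_of_one_le_right hX hQ
  rcases min_choice (d / 4) (min ϑ (1 / (20 * Q))) with hmin | hmin <;> rw [hmin]
  · calc 16 * n * Y * (d / (d / 4)) = 64 * (n * Y) := by field_simp; ring
      _ ≤ X * (1 / √(2 * (n : ℝ))) := by linarith
      _ ≤ X * Q * (1 / √(2 * (n : ℝ)) + 2 * d + d / ϑ) := by gcongr; linarith
  rcases min_choice ϑ (1 / (20 * Q)) with hmin' | hmin' <;> rw [hmin']
  · have hcoeff : 16 * n * Y ≤ X * Q := by linarith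
    calc 16 * n * Y * (d / ϑ) ≤ X * Q * (d / ϑ) := by gcongr
      _ ≤ X * Q * (1 / √(2 * (n : ℝ)) + 2 * d + d / ϑ) := by gcongr; linarith
  · calc 16 * n * Y * (d / (1 / (20 * Q))) = 160 * n * Y * Q * (2 * d) := by
          field_simp
          ring
      _ ≤ X * Q * (1 / √(2 * (n : ℝ)) + 2 * d + d / ϑ) := by gcongr; linarith

theorem add_pow_mul_div_radius_le {n m : ℕ} (hn : 2 ≤ n) (hm : 2 * n = m + 1) {d ϑ Q C r : ℝ}
    (hd : 0 < d) (hϑ : 0 < ϑ) (hQ : 1 ≤ Q) (hC : 0 ≤ C)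
    (hr : r = min (d / 4) (min ϑ (1 / (20 * Q)))) :
    (d + 2 * (r / 2)) ^ (m + 1) * (((m : ℝ) + 1) / (2 * (r / 2))) * (8 * C) ≤
      3 * (2 * Real.pi * Real.exp 1) ^ n * Q * d ^ m *
        (1 / √(2 * (n : ℝ)) + 2 * d + d / ϑ) * C := by
  have hr0 : 0 < r := hr ▸ lt_min (by positivity) (lt_min hϑ (by positivity))
  have hrd : r ≤ d / 4 := hr ▸ min_le_left _ _
  have hm' : (m : ℝ) + 1 = 2 * n := by exact_mod_cast hm.symm
  have hpow : (d + 2 * (r / 2)) ^ (m + 1) ≤ (25 / 16) ^ n * d ^ (m + 1) := by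
    calc (d + 2 * (r / 2)) ^ (m + 1) ≤ (5 / 4 * d) ^ (m + 1) := by gcongr; linarith
      _ = (25 / 16) ^ n * d ^ (m + 1) := by rw [mul_pow, ← hm, pow_mul (5 / 4 : ℝ)]; norm_num
  calc (d + 2 * (r / 2)) ^ (m + 1) * (((m : ℝ) + 1) / (2 * (r / 2))) * (8 * C)
      ≤ (25 / 16) ^ n * d ^ (m + 1) * (2 * n / (2 * (r / 2))) * (8 * C) := by
        rw [hm']
        gcongr
    _ = 16 * n * (25 / 16) ^ n * (d / r) * d ^ m * C := by field_simp; ring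
    _ ≤ 3 * (2 * Real.pi * Real.exp 1) ^ n * Q * (1 / √(2 * (n : ℝ)) + 2 * d + d / ϑ) *
          d ^ m * C := by
        gcongr ?_ * _ * _
        exact hr ▸ mul_diam_div_radius_le hn hd hϑ hQ
    _ = _ := by ring

variable {V H : Type*} [NormedAddCommGroup V] [InnerProductSpace ℝ V]
  [NormedAddCommGroup H] [InnerProductSpace ℝ H] {φ φ' : V → H} {μ : ℕ} {β F δ G r x : ℝ}

theorem volume_preimage_add_smul_ball_le (x₀ z : V) {a : V} (ha : ‖a‖ = 1) (ρ : ℝ) :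
    volume ((fun t : ℝ => z + t • a) ⁻¹' Metric.ball x₀ ρ) ≤ ENNReal.ofReal (2 * ρ) := by
  refine (Real.volume_le_diam _).trans (Metric.ediam_le fun s hs t ht => ?_)
  rw [edist_dist]
  refine ENNReal.ofReal_le_ofReal ?_
  calc dist s t = dist (z + s • a) (z + t • a) := by
        rw [dist_add_left, dist_eq_norm (s • a), ← sub_smul, norm_smul, ha, mul_one, dist_eq_norm]
    _ ≤ ρ + ρ := (dist_triangle_right _ _ x₀).trans
        (add_le_add (Metric.mem_ball.1 hs).le (Metric.mem_ball.1 ht).le)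
    _ = 2 * ρ := (two_mul ρ).symm

theorem exists_direction_volume_section_inter_ball_le (hμ : 0 < μ) {K : Set V}
    (hφ : ContDiffOn ℝ (μ + 1 : ℕ) φ (Metric.thickening r K))
    (hφ' : ContDiffOn ℝ μ φ' (Metric.thickening r K))
    (hF : CkNormLE μ φ F (Metric.thickening r K))
    (hδ : CkNormLE μ (fun z => φ z - φ' z) δ (Metric.thickening r K))
    (hG : CkNormLE (μ + 1) (fun z => ‖φ z‖ ^ 2) G (Metric.thickening r K)) (hβ : 0 < β)
    (hδF : δ * (F + δ) ≤ β / 2 ^ (μ + 1)) (hβG : β ≤ G) (hr : 0 < r)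
    (hrG : r * (polarConst (μ + 1) * G) ≤ β / 20)
    (hK : ∀ y ∈ K, ∃ k ≤ μ, ∃ a : V, ‖a‖ = 1 ∧ β ≤ |dirDeriv k (fun z => ‖φ z‖ ^ 2) a y|)
    (hx : 0 < x) {x₀ : V}
    (hx₀ : ({y ∈ K | ‖φ' y‖ ^ 2 ≤ x ^ μ * β} ∩ Metric.ball x₀ (r / 2)).Nonempty) :
    ∃ a : V, ‖a‖ = 1 ∧ ∀ z : V, volume ((fun t : ℝ => z + t • a) ⁻¹'
      ({y ∈ K | ‖φ' y‖ ^ 2 ≤ x ^ μ * β} ∩ Metric.ball x₀ (r / 2))) ≤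
        ENNReal.ofReal (8 * (μ + 1) * x) := by
  obtain ⟨y, ⟨hyK, -⟩, hyx⟩ := hx₀
  rcases le_or_gt r (8 * (μ + 1) * x) with hle | hlt
  · obtain ⟨-, -, a, ha, -⟩ := hK y hyK
    refine ⟨a, ha, fun z => (measure_mono (Set.preimage_mono Set.inter_subset_right)).trans
      ((volume_preimage_add_smul_ball_le x₀ z ha (r / 2)).trans (ENNReal.ofReal_le_ofReal ?_))⟩
    linarith
  · have hball : Metric.ball y r ⊆ Metric.thickening r K := fun z hz =>
      Metric.mem_thickening_iff.2 ⟨y, hyK, hz⟩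
    obtain ⟨a, ha, hsection⟩ := exists_direction_volume_section_le hμ (hφ.mono hball)
      (hφ'.mono hball) (hF.mono le_rfl hball) (hδ.mono le_rfl hball) (hG.mono le_rfl hball) hβ hδF
      hβG hr hrG (hK y hyK) hx hlt
    refine ⟨a, ha, fun z => (measure_mono (Set.preimage_mono fun b hb => ?_)).trans (hsection z)⟩
    refine ⟨Metric.mem_ball.2 ((dist_triangle_right b y x₀).trans_lt ?_), hb.1.2⟩
    linarith [Metric.mem_ball.1 hb.2, Metric.mem_ball.1 hyx]

/-- The radius `r` of the local estimates is chosen so that `‖φ‖²` varies little at scale `r`. -/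
theorem volume_normSq_le_le [FiniteDimensional ℝ V] [MeasurableSpace V] [BorelSpace V] {n : ℕ}
    (hn : 2 ≤ n) (hV : Module.finrank ℝ V = 2 * n) {K : Set V} (hK : IsCompact K)
    (hd : 0 < Metric.diam K) {ϑ : ℝ} (hϑ : 0 < ϑ) (hμ : 0 < μ)
    (hφ : ContDiffOn ℝ (μ + 1 : ℕ) φ (Metric.thickening ϑ K))
    (hφ' : ContDiffOn ℝ μ φ' (Metric.thickening ϑ K))
    (hF : CkNormLE μ φ F (Metric.thickening ϑ K))
    (hδ : CkNormLE μ (fun z => φ z - φ' z) δ (Metric.thickening ϑ K))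
    (hG : CkNormLE (μ + 1) (fun z => ‖φ z‖ ^ 2) G (Metric.thickening ϑ K)) (hβ : 0 < β)
    (hδF : δ * (F + δ) ≤ β / 2 ^ (μ + 1)) (hβG : β ≤ G)
    (hβK : ∀ y ∈ K, ∃ k ≤ μ, ∃ a : V, ‖a‖ = 1 ∧ β ≤ |dirDeriv k (fun z => ‖φ z‖ ^ 2) a y|)
    (hx : 0 < x) :
    volume {y ∈ K | ‖φ' y‖ ^ 2 ≤ x ^ μ * β} ≤ ENNReal.ofReal
      (3 * (2 * Real.pi * Real.exp 1) ^ n * (polarConst (μ + 1) * (μ + 1)) *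
        Metric.diam K ^ (2 * n - 1) *
        (1 / √(2 * (n : ℝ)) + 2 * Metric.diam K + Metric.diam K / ϑ) * (G / β) * x) := by
  set d := Metric.diam K
  obtain ⟨m, hm⟩ : ∃ m, 2 * n = m + 1 := ⟨2 * n - 1, by omega⟩
  have hP2 : 2 ≤ polarConst (μ + 1) := two_le_polarConst (by omega)
  have hG0 : 0 < G := hβ.trans_le hβG
  have hGβ : 1 ≤ G / β := (one_le_div hβ).2 hβG
  have hQ : 1 ≤ polarConst (μ + 1) * (G / β) := one_le_mul_of_one_le_of_one_le (by linarith) hGβ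
  set r := min (d / 4) (min ϑ (1 / (20 * (polarConst (μ + 1) * (G / β))))) with hr_def
  have hr : 0 < r := lt_min (by positivity) (lt_min hϑ (by positivity))
  have hrϑ : r ≤ ϑ := (min_le_right _ _).trans (min_le_left _ _)
  have hrG : r * (polarConst (μ + 1) * G) ≤ β / 20 := by
    calc r * (polarConst (μ + 1) * G)
        ≤ 1 / (20 * (polarConst (μ + 1) * (G / β))) * (polarConst (μ + 1) * G) := by
          gcongr
          exact (min_le_right _ _).trans (min_le_right _ _)
      _ = β / 20 := by field_simp
  have hthick : Metric.thickening r K ⊆ Metric.thickening ϑ K := Metric.thickening_mono hrϑ K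
  have hclosed : IsClosed {y ∈ K | ‖φ' y‖ ^ 2 ≤ x ^ μ * β} :=
    ((hφ'.continuousOn.mono (Metric.self_subset_thickening hϑ K)).norm.pow
      2).preimage_isClosed_of_isClosed hK.isClosed isClosed_Iic
  refine (volume_le_of_local_volume_sections_le (by omega) (hV.trans hm) hclosed.measurableSet
    (fun y hy => hy.1) hK.isBounded (half_pos hr) fun x₀ hx₀ =>
      exists_direction_volume_section_inter_ball_le hμ (hφ.mono hthick) (hφ'.mono hthick)
        (hF.mono le_rfl hthick) (hδ.mono le_rfl hthick) (hG.mono le_rfl hthick) hβ hδF hβG hr hrG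
        hβK hx hx₀).trans (ENNReal.ofReal_le_ofReal ?_)
  have hconst := add_pow_mul_div_radius_le (C := (μ + 1) * x) hn hm hd hϑ hQ (by positivity) hr_def
  rw [show 2 * n - 1 = m by omega]
  linarith

end MeasureEstimate

/-! ### Counting weights -/

section DegreeBlocks

/-- The pairs `(Q, i)` indexing the weights `α_{Q,i}` of degree in `[2^(k-1) + 1, 2^k]`. -/
def degreeBlock (n k : ℕ) : Finset ((Fin n → ℕ) × Fin n) :=
  ((Finset.Icc (2 ^ (k - 1) + 1) (2 ^ k)).biUnion fun m => Finset.piAntidiag Finset.univ m) ×ˢ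
    Finset.univ

theorem mem_degreeBlock {n k : ℕ} {p : (Fin n → ℕ) × Fin n} :
    p ∈ degreeBlock n k ↔ 2 ^ (k - 1) + 1 ≤ ∑ j, p.1 j ∧ ∑ j, p.1 j ≤ 2 ^ k := by
  simp [degreeBlock]

theorem card_piAntidiag_univ_fin (n m : ℕ) :
    (Finset.piAntidiag (Finset.univ : Finset (Fin n)) m).card = (n + m - 1).choose m := by
  rw [← Finset.map_sym_eq_piAntidiag, Finset.card_map, Finset.sym_univ, Finset.card_univ,
    Sym.card_sym_eq_choose, Fintype.card_fin]

theorem card_degreeBlock_succ_le {n : ℕ} (hn : 1 ≤ n) (k : ℕ) :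
    ((degreeBlock n (k + 1)).card : ℝ) ≤
      n * 2 ^ k * (2 ^ (k + 1) + n + 1) ^ (n - 1) / ((n - 1).factorial : ℝ) := by
  set s := Finset.Icc (2 ^ k + 1) (2 ^ (k + 1))
  have hdegree : ∀ m ∈ s, ((Finset.piAntidiag (Finset.univ : Finset (Fin n)) m).card : ℝ) ≤
      ((2 : ℝ) ^ (k + 1) + n + 1) ^ (n - 1) / ((n - 1).factorial : ℝ) := fun m hm => by
    rw [card_piAntidiag_univ_fin, Nat.choose_symm_of_eq_add (b := n - 1) (by omega)]
    refine (Nat.choose_le_pow_div (α := ℝ) _ _).trans ?_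
    gcongr
    have hle : n + m - 1 ≤ 2 ^ (k + 1) + n + 1 := by have := (Finset.mem_Icc.1 hm).2; omega
    exact_mod_cast hle
  have hs : s.card = 2 ^ k := by rw [Nat.card_Icc, pow_succ]; omega
  have hunion : ((s.biUnion fun m => Finset.piAntidiag (Finset.univ : Finset (Fin n)) m).card : ℝ) ≤
      2 ^ k * (((2 : ℝ) ^ (k + 1) + n + 1) ^ (n - 1) / ((n - 1).factorial : ℝ)) := by
    calc _ ≤ ∑ m ∈ s, ((Finset.piAntidiag (Finset.univ : Finset (Fin n)) m).card : ℝ) := by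
          exact_mod_cast Finset.card_biUnion_le
      _ ≤ s.card • (((2 : ℝ) ^ (k + 1) + n + 1) ^ (n - 1) / ((n - 1).factorial : ℝ)) :=
          Finset.sum_le_card_nsmul _ _ _ hdegree
      _ = _ := by rw [hs, nsmul_eq_mul]; push_cast; rfl
  rw [degreeBlock, Nat.add_sub_cancel, Finset.card_product, Finset.card_univ, Fintype.card_fin,
    Nat.cast_mul]
  calc _ ≤ 2 ^ k * (((2 : ℝ) ^ (k + 1) + n + 1) ^ (n - 1) / ((n - 1).factorial : ℝ)) * n := by
        gcongr
    _ = _ := by ring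

theorem two_pow_div_sq_le_sub (k : ℕ) :
    (2 : ℝ) ^ k / (2 ^ (k + 1) + 3) ^ 2 ≤ 1 / (2 ^ k + 3) - 1 / (2 ^ (k + 1) + 3) := by
  have hy : (0 : ℝ) < 2 ^ k := by positivity
  rw [pow_succ (2 : ℝ) k]
  generalize (2 : ℝ) ^ k = y at hy ⊢
  calc y / (y * 2 + 3) ^ 2 ≤ y / ((y + 3) * (y * 2 + 3)) := by
        rw [pow_two]
        gcongr
        linarith
    _ = 1 / (y + 3) - 1 / (y * 2 + 3) := by field_simp; ring

theorem sum_two_pow_div_sq_le (N : ℕ) :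
    ∑ k ∈ Finset.range N, (2 : ℝ) ^ k / (2 ^ (k + 1) + 3) ^ 2 ≤ 0.224 := by
  have htail : ∑ k ∈ Finset.range N, (2 : ℝ) ^ (k + 2) / (2 ^ (k + 2 + 1) + 3) ^ 2 ≤ 1 / 7 := by
    calc _ ≤ ∑ k ∈ Finset.range N,
            (1 / ((2 : ℝ) ^ (k + 2) + 3) - 1 / ((2 : ℝ) ^ (k + 1 + 2) + 3)) :=
          Finset.sum_le_sum fun k _ => two_pow_div_sq_le_sub (k + 2)
      _ = 1 / ((2 : ℝ) ^ (0 + 2) + 3) - 1 / ((2 : ℝ) ^ (N + 2) + 3) :=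
          Finset.sum_range_sub' (fun k => 1 / ((2 : ℝ) ^ (k + 2) + 3)) N
      _ ≤ 1 / ((2 : ℝ) ^ (0 + 2) + 3) := sub_le_self _ (by positivity)
      _ = 1 / 7 := by norm_num
  calc ∑ k ∈ Finset.range N, (2 : ℝ) ^ k / (2 ^ (k + 1) + 3) ^ 2
      ≤ ∑ k ∈ Finset.range (N + 2), (2 : ℝ) ^ k / (2 ^ (k + 1) + 3) ^ 2 :=
        Finset.sum_le_sum_of_subset_of_nonneg (Finset.range_mono (by omega))
          fun _ _ _ => by positivity
    _ ≤ 1 / 7 + 2 / 49 + 1 / 25 := by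
        rw [Finset.sum_range_succ', Finset.sum_range_succ']
        norm_num at htail ⊢
        linarith
    _ ≤ 0.224 := by norm_num

theorem add_one_mul_le_of_add_three_pow_mul_le {n : ℕ} (hn : 2 ≤ n) {a M : ℝ} (ha : 0 ≤ a)
    (h : ((n : ℝ) + 3) ^ (n + 1) * a ≤ M) : ((n : ℝ) + 1) * a ≤ 0.012 * n * M := by
  have hn' : (2 : ℝ) ≤ n := by exact_mod_cast hn
  have hcube : (n : ℝ) + 1 ≤ 0.012 * n * (n + 3) ^ 3 := by
    nlinarith [pow_nonneg (zero_le_two.trans hn') 3, sq_nonneg ((n : ℝ) - 2)]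
  calc ((n : ℝ) + 1) * a ≤ 0.012 * n * (n + 3) ^ 3 * a := by gcongr
    _ ≤ 0.012 * n * (n + 3) ^ (n + 1) * a := by
        gcongr
        · linarith
        · omega
    _ = 0.012 * n * ((n + 3) ^ (n + 1) * a) := by ring
    _ ≤ 0.012 * n * M := by gcongr

theorem card_degreeBlock_succ_mul_le {n : ℕ} (hn : 2 ≤ n) {a M : ℝ} {k : ℕ} (ha : 0 ≤ a)
    (haM : ((2 : ℝ) ^ (k + 1) + n + 1) ^ (n + 1) * a ≤ M) :
    ((degreeBlock n (k + 1)).card : ℝ) * a ≤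
      n * M / ((n - 1).factorial : ℝ) * ((2 : ℝ) ^ k / (2 ^ (k + 1) + 3) ^ 2) := by
  have hn' : (2 : ℝ) ≤ n := by exact_mod_cast hn
  set X : ℝ := 2 ^ (k + 1) + n + 1 with hX
  have hX0 : 0 < X := by positivity
  have hX3 : (2 : ℝ) ^ (k + 1) + 3 ≤ X := by linarith
  have hXa : X ^ (n - 1) * a ≤ M / (2 ^ (k + 1) + 3) ^ 2 := by
    rw [le_div_iff₀ (by positivity)]
    calc X ^ (n - 1) * a * (2 ^ (k + 1) + 3) ^ 2 ≤ X ^ (n - 1) * a * X ^ 2 := by gcongr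
      _ = X ^ (n + 1) * a := by rw [show n + 1 = (n - 1) + 2 by omega, pow_add]; ring
      _ ≤ M := haM
  calc ((degreeBlock n (k + 1)).card : ℝ) * a
      ≤ n * 2 ^ k * X ^ (n - 1) / ((n - 1).factorial : ℝ) * a := by
        gcongr
        exact card_degreeBlock_succ_le (by omega) k
    _ = n * 2 ^ k / ((n - 1).factorial : ℝ) * (X ^ (n - 1) * a) := by ring
    _ ≤ n * 2 ^ k / ((n - 1).factorial : ℝ) * (M / (2 ^ (k + 1) + 3) ^ 2) := by gcongr
    _ = _ := by ring

/-- The sum is at most `0.224 n M / (n-1)!`, and the negative term on the right at most `0.012 n M`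
in absolute value. -/
theorem sum_card_degreeBlock_mul_le {n : ℕ} (hn : 2 ≤ n) {a : ℕ → ℝ} {M : ℝ}
    (ha : ∀ k, 1 ≤ k → 0 ≤ a k) (hM : ∀ k : ℕ, 1 ≤ k → ((2 : ℝ) ^ k + n + 1) ^ (n + 1) * a k ≤ M)
    (N : ℕ) :
    ∑ k ∈ Finset.range N, ((degreeBlock n (k + 1)).card : ℝ) * a (k + 1) ≤
      ((2 ^ 2 + (n : ℝ)) ^ n * a 2 - ((n : ℝ) + 1) * a 1 + (n : ℝ) / 4 * M) /
        ((n - 1).factorial : ℝ) := by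
  have hM0 : 0 ≤ n * M := mul_nonneg n.cast_nonneg
    ((mul_nonneg (by positivity) (ha 1 le_rfl)).trans (hM 1 le_rfl))
  have ha₁ : ((n : ℝ) + 1) * a 1 ≤ 0.012 * n * M := by
    refine add_one_mul_le_of_add_three_pow_mul_le hn (ha 1 le_rfl) (le_of_eq_of_le ?_ (hM 1 le_rfl))
    ring
  have ha₂ : 0 ≤ (2 ^ 2 + (n : ℝ)) ^ n * a 2 := mul_nonneg (by positivity) (ha 2 one_le_two)
  calc ∑ k ∈ Finset.range N, ((degreeBlock n (k + 1)).card : ℝ) * a (k + 1)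
      ≤ ∑ k ∈ Finset.range N,
          n * M / ((n - 1).factorial : ℝ) * ((2 : ℝ) ^ k / (2 ^ (k + 1) + 3) ^ 2) :=
        Finset.sum_le_sum fun k _ =>
          card_degreeBlock_succ_mul_le hn (ha _ (by omega)) (hM _ (by omega))
    _ ≤ n * M / ((n - 1).factorial : ℝ) * 0.224 := by
        rw [← Finset.mul_sum]
        gcongr
        exact sum_two_pow_div_sq_le N
    _ = n * M * 0.224 / ((n - 1).factorial : ℝ) := by ring
    _ ≤ _ := by
        gcongr
        generalize (2 ^ 2 + (n : ℝ)) ^ n * a 2 = b at ha₂ ⊢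
        linarith

end DegreeBlocks

/-! ### Bounds on `C^p` norms -/

section CkNormBounds

variable {E F G : Type*} [NormedAddCommGroup E] [NormedSpace ℝ E]
  [NormedAddCommGroup F] [NormedSpace ℝ F] [NormedAddCommGroup G] [NormedSpace ℝ G]
  {p : ℕ} {f : E → F} {B U K : Set E} {y : E} {C ϑ : ℝ}

theorem ckNormOn_le_ofReal_iff (hC : 0 ≤ C) :
    ckNormOn B p f ≤ ENNReal.ofReal C ↔ CkNormLE p f C B := by
  simp only [ckNormOn, ckNormAt, iSup_le_iff, CkNormLE, dirDeriv, ← ofReal_norm,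
    ENNReal.ofReal_le_ofReal_iff hC]

theorem ckNormLE_toReal_ckNormOn (h : ckNormOn B p f ≠ ⊤) :
    CkNormLE p f (ckNormOn B p f).toReal B :=
  (ckNormOn_le_ofReal_iff ENNReal.toReal_nonneg).1 (ENNReal.ofReal_toReal h).ge

theorem CkNormLE.ckNormOn_ne_top (hC : 0 ≤ C) (h : CkNormLE p f C B) : ckNormOn B p f ≠ ⊤ :=
  ne_top_of_le_ne_top ENNReal.ofReal_ne_top ((ckNormOn_le_ofReal_iff hC).2 h)

theorem ckNormAt_le_ckNormOn (hy : y ∈ B) (p : ℕ) (f : E → F) : ckNormAt p f y ≤ ckNormOn B p f :=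
  le_iSup₂_of_le y hy le_rfl

theorem ckNormOn_le_of_le {q : ℕ} (hpq : p ≤ q) (f : E → F) : ckNormOn B p f ≤ ckNormOn B q f :=
  iSup₂_mono fun _ _ => iSup_mono fun _ => iSup_mono' fun h => ⟨h.trans hpq, le_rfl⟩

theorem exists_enorm_dirDeriv_eq_ckNormAt [ProperSpace E] (h : 0 < ckNormAt p f y) :
    ∃ k ≤ p, ∃ a : E, ‖a‖ = 1 ∧ ‖dirDeriv k f a y‖ₑ = ckNormAt p f y := by
  have hcompact : IsCompact (Set.Iic p ×ˢ Metric.sphere (0 : E) 1) :=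
    (Set.finite_Iic p).isCompact.prod (isCompact_sphere 0 1)
  have hcont : Continuous fun x : ℕ × E => ‖dirDeriv x.1 f x.2 y‖ₑ :=
    continuous_prod_of_discrete_left.2 fun k =>
      ((iteratedFDeriv ℝ k f y).cont.comp (continuous_pi fun _ => continuous_id)).enorm
  have hne : (Set.Iic p ×ˢ Metric.sphere (0 : E) 1).Nonempty := by
    simp only [ckNormAt, lt_iSup_iff] at h
    obtain ⟨k, hk, a, ha, -⟩ := h
    exact ⟨(k, a), hk, mem_sphere_zero_iff_norm.2 ha⟩
  obtain ⟨⟨k, a⟩, ⟨hk, ha⟩, hmax⟩ := hcompact.exists_isMaxOn hne hcont.continuousOn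
  rw [mem_sphere_zero_iff_norm] at ha
  refine ⟨k, hk, a, ha, le_antisymm (le_iSup₂_of_le k hk (le_iSup₂_of_le a ha le_rfl)) ?_⟩
  exact iSup₂_le fun j hj => iSup₂_le fun b hb =>
    hmax (show (j, b) ∈ _ from ⟨hj, mem_sphere_zero_iff_norm.2 hb⟩)

theorem exists_ckNormLE_of_isCompact (hU : IsOpen U) (hf : ContDiffOn ℝ p f U) (hK : IsCompact K)
    (hKU : K ⊆ U) : ∃ C, 0 ≤ C ∧ CkNormLE p f C K := by
  have hbound : ∀ j : ℕ, ∃ C : ℝ, j ≤ p → ∀ y ∈ K, ‖iteratedFDeriv ℝ j f y‖ ≤ C := fun j => by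
    by_cases hj : j ≤ p
    · have hcont : ContinuousOn (iteratedFDeriv ℝ j f) U :=
        (hf.continuousOn_iteratedFDerivWithin (by exact_mod_cast hj) hU.uniqueDiffOn).congr
          fun z hz => (iteratedFDerivWithin_of_isOpen j hU hz).symm
      obtain ⟨C, hC⟩ := hK.exists_bound_of_continuousOn (hcont.mono hKU)
      exact ⟨C, fun _ => hC⟩
    · exact ⟨0, fun h => absurd h hj⟩
  choose C hC using hbound
  refine ⟨∑ j ∈ Finset.range (p + 1), |C j|, by positivity, fun y hy j hj a ha => ?_⟩
  calc ‖dirDeriv j f a y‖ ≤ ‖iteratedFDeriv ℝ j f y‖ * ∏ _i : Fin j, ‖a‖ :=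
        (iteratedFDeriv ℝ j f y).le_opNorm _
    _ = ‖iteratedFDeriv ℝ j f y‖ := by simp [ha]
    _ ≤ |C j| := (hC j hj y hy).trans (le_abs_self _)
    _ ≤ _ := Finset.single_le_sum (f := fun j => |C j|) (fun _ _ => abs_nonneg _)
        (Finset.mem_range_succ_iff.2 hj)

theorem exists_ckNormLE_thickening [ProperSpace E] (hU : IsOpen U) (hf : ContDiffOn ℝ p f U)
    (hK : IsCompact K) (hϑU : Metric.cthickening ϑ K ⊆ U) :
    ∃ C, 0 ≤ C ∧ CkNormLE p f C (Metric.thickening ϑ K) := by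
  obtain ⟨C, hC0, hC⟩ := exists_ckNormLE_of_isCompact hU hf hK.cthickening hϑU
  exact ⟨C, hC0, hC.mono le_rfl (Metric.thickening_subset_cthickening ϑ K)⟩

theorem CkNormLE.clm_comp {L : F →L[ℝ] G} (hL : ‖L‖ ≤ 1) (hB : IsOpen B)
    (hf : ContDiffOn ℝ p f B) (h : CkNormLE p f C B) : CkNormLE p (fun z => L (f z)) C B :=
  fun z hz j hj a ha => by
    rw [dirDeriv_clm_comp L ((hf.contDiffAt (hB.mem_nhds hz)).of_le (by exact_mod_cast hj)) a]
    exact (L.le_of_opNorm_le hL _).trans (by rw [one_mul]; exact h z hz j hj a ha)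

theorem CkNormLE.normSq {H : Type*} [NormedAddCommGroup H] [InnerProductSpace ℝ H] {φ : E → H}
    (hB : IsOpen B) (hφ : ContDiffOn ℝ p φ B) (h : CkNormLE p φ C B) :
    CkNormLE p (fun z => ‖φ z‖ ^ 2) (2 ^ p * C ^ 2) B := fun z hz j hj a ha => by
  rw [Real.norm_eq_abs]
  refine (abs_dirDeriv_normSq_le hB (hφ.of_le (by exact_mod_cast hj)) hz a
    fun i hi => h z hz i (hi.trans hj) a ha).trans ?_
  gcongr
  norm_num

theorem cthickening_subset_of_lt_iInf {X : Type*} [PseudoEMetricSpace X] {U K : Set X}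
    (h : ENNReal.ofReal ϑ < ⨅ x ∈ K, Metric.infEDist x Uᶜ) : Metric.cthickening ϑ K ⊆ U := by
  intro z hz
  by_contra hzU
  have hle : ⨅ x ∈ K, Metric.infEDist x Uᶜ ≤ Metric.infEDist z K :=
    Metric.le_infEDist.2 fun x hx => (iInf₂_le x hx).trans
      ((Metric.infEDist_le_edist_of_mem hzU).trans_eq (edist_comm x z))
  exact (hle.trans (Metric.mem_cthickening_iff.1 hz)).not_gt h

end CkNormBounds

/-! ### The pairing `(c, f)` -/

section Pairing

variable {n l : ℕ}

/-- The linear form `x ↦ ∑ j, c_j x_j` on `ℂ^l`, over the reals because so are all derivatives. -/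
noncomputable def pairing (c : CSpace l) : CSpace l →L[ℝ] ℂ :=
  (innerSL ℂ (WithLp.toLp 2 fun j => star (c j) : CSpace l)).restrictScalars ℝ

theorem pairing_apply (c x : CSpace l) : pairing c x = ∑ j, c j * x j := by
  simp [pairing, PiLp.inner_apply, mul_comm]

theorem norm_pairing (c : CSpace l) : ‖pairing c‖ = ‖c‖ := by
  rw [pairing, ContinuousLinearMap.norm_restrictScalars, innerSL_apply_norm]
  simp [EuclideanSpace.norm_eq]

theorem norm_pairing_smul (t : ℝ) (c x : CSpace l) :
    ‖pairing ((t : ℂ) • c) x‖ = |t| * ‖pairing c x‖ := by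
  rw [← Real.norm_eq_abs, ← Complex.norm_real, ← norm_mul, pairing_apply, pairing_apply,
    Finset.mul_sum]
  simp only [PiLp.smul_apply, smul_eq_mul, mul_assoc]

theorem pairSq_eq (c : CSpace l) (f : CSpace n → CSpace l) :
    pairSq c f = fun y => ‖pairing c (f y)‖ ^ 2 := by
  funext y
  rw [pairSq, pairing_apply]

theorem finrank_real_CSpace : Module.finrank ℝ (CSpace n) = 2 * n := by
  rw [finrank_real_of_complex, finrank_euclideanSpace_fin]

end Pairing

/-! ### Sublevel sets of perturbed nondegenerate maps -/

section NondegenerateMeasure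

variable {n l : ℕ} {f f' : CSpace n → CSpace l} {U K : Set (CSpace n)} {ϑ : ℝ} {c : CSpace l}

theorem constB_eq (n μ : ℕ) :
    constB n μ = 3 * (2 * Real.pi * Real.exp 1) ^ n * (polarConst (μ + 1) * (μ + 1)) := by
  rw [constB, polarConst, pow_succ ((μ : ℝ) + 1) (μ + 1)]
  push_cast
  ring

theorem constM_nonneg (f : CSpace n → CSpace l) (K : Set (CSpace n)) (hϑ : 0 < ϑ) :
    0 ≤ constM f K ϑ := by
  have hβ : 0 ≤ nondegAmount f K := ENNReal.toReal_nonneg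
  have hB : 0 ≤ constB n (nondegIndex f K) := by
    have := Real.pi_pos
    unfold constB
    positivity
  have hd : 0 ≤ Metric.diam K := Metric.diam_nonneg
  unfold constM
  positivity

theorem closenessBound_nonneg (f : CSpace n → CSpace l) (K : Set (CSpace n)) (ϑ : ℝ) :
    0 ≤ closenessBound f K ϑ := by
  have hβ : (0 : ℝ) ≤ nondegAmount f K / (2 : ℝ) ^ ((nondegIndex f K : ℤ) - 1) :=
    div_nonneg ENNReal.toReal_nonneg (by positivity)
  have hsqrt : (ckNormOn (Metric.thickening ϑ K) (nondegIndex f K) f).toReal ≤ √(_ + _) :=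
    Real.le_sqrt_of_sq_le (le_add_of_nonneg_right hβ)
  unfold closenessBound
  linarith

theorem closenessBound_mul_add (f : CSpace n → CSpace l) (K : Set (CSpace n)) (ϑ : ℝ) :
    closenessBound f K ϑ *
      ((ckNormOn (Metric.thickening ϑ K) (nondegIndex f K) f).toReal + closenessBound f K ϑ) =
      nondegAmount f K / 2 ^ (nondegIndex f K + 1) := by
  have hβ0 : 0 ≤ nondegAmount f K / (2 : ℝ) ^ ((nondegIndex f K : ℤ) - 1) :=
    div_nonneg ENNReal.toReal_nonneg (by positivity)
  have hβ : nondegAmount f K / (2 : ℝ) ^ ((nondegIndex f K : ℤ) - 1) =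
      4 * (nondegAmount f K / 2 ^ (nondegIndex f K + 1)) := by
    rw [zpow_sub_one₀ two_ne_zero, zpow_natCast, pow_succ]
    field_simp
    norm_num
  have hsq := Real.sq_sqrt (add_nonneg
    (sq_nonneg (ckNormOn (Metric.thickening ϑ K) (nondegIndex f K) f).toReal) hβ0)
  rw [closenessBound]
  rw [hβ] at hsq ⊢
  generalize √_ = s at hsq ⊢
  linear_combination hsq / 4

theorem iSup_ckNormOn_pairSq_ne_top {p : ℕ} (hU : IsOpen U) (hf : ContDiffOn ℝ p f U)
    (hK : IsCompact K) (hϑU : Metric.cthickening ϑ K ⊆ U) :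
    (⨆ c : CSpace l, ⨆ _ : ‖c‖ = 1, ckNormOn (Metric.thickening ϑ K) p (pairSq c f)) ≠ ⊤ := by
  obtain ⟨C, -, hC⟩ := exists_ckNormLE_thickening hU hf hK hϑU
  have hfϑ := hf.mono ((Metric.thickening_subset_cthickening _ _).trans hϑU)
  refine ne_top_of_le_ne_top (ENNReal.ofReal_ne_top (r := 2 ^ p * C ^ 2))
    (iSup₂_le fun c hc => (ckNormOn_le_ofReal_iff (by positivity)).2 ?_)
  rw [pairSq_eq]
  exact (hC.clm_comp ((norm_pairing c).trans hc).le Metric.isOpen_thickening hfϑ).normSq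
    Metric.isOpen_thickening ((pairing c).contDiff.comp_contDiffOn hfϑ)

theorem nondegBeta_le_ckNormAt {μ : ℕ} {y : CSpace n} (hy : y ∈ K) (hc : ‖c‖ = 1) :
    nondegBeta μ f K ≤ ckNormAt μ (pairSq c f) y :=
  iInf₂_le_of_le y hy (iInf₂_le c hc)

theorem nondegBeta_le_ckNormOn_thickening {μ : ℕ} (hK : K.Nonempty) (hϑ : 0 < ϑ) (hc : ‖c‖ = 1) :
    nondegBeta μ f K ≤ ckNormOn (Metric.thickening ϑ K) μ (pairSq c f) := by
  obtain ⟨y, hy⟩ := hK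
  exact (nondegBeta_le_ckNormAt hy hc).trans
    (ckNormAt_le_ckNormOn (Metric.self_subset_thickening hϑ K hy) μ _)

theorem nondegBeta_nondegIndex_pos (hμ : 0 < nondegIndex f K) :
    0 < nondegBeta (nondegIndex f K) f K :=
  (Nat.sInf_mem (Nat.nonempty_of_pos_sInf hμ)).2

theorem exists_nondegAmount_le_abs_dirDeriv (hμ : 0 < nondegIndex f K) {y : CSpace n} (hy : y ∈ K)
    (hc : ‖c‖ = 1) :
    ∃ k ≤ nondegIndex f K, ∃ a : CSpace n, ‖a‖ = 1 ∧
      nondegAmount f K ≤ |dirDeriv k (fun z => ‖pairing c (f z)‖ ^ 2) a y| := by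
  have hle := nondegBeta_le_ckNormAt (μ := nondegIndex f K) (f := f) hy hc
  obtain ⟨k, hk, a, ha, heq⟩ :=
    exists_enorm_dirDeriv_eq_ckNormAt ((nondegBeta_nondegIndex_pos hμ).trans_le hle)
  refine ⟨k, hk, a, ha, ?_⟩
  rw [← pairSq_eq, ← Real.norm_eq_abs, ← toReal_enorm]
  exact ENNReal.toReal_mono enorm_ne_top (hle.trans_eq heq.symm)

theorem nondegAmount_pos (hU : IsOpen U) (hf : ContDiffOn ℝ (nondegIndex f K : ℕ) f U)
    (hK : IsCompact K) (hKne : K.Nonempty) (hϑ : 0 < ϑ) (hϑU : Metric.cthickening ϑ K ⊆ U)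
    (hμ : 0 < nondegIndex f K) (hc : ‖c‖ = 1) : 0 < nondegAmount f K :=
  ENNReal.toReal_pos (nondegBeta_nondegIndex_pos hμ).ne' (ne_top_of_le_ne_top
    (iSup_ckNormOn_pairSq_ne_top hU hf hK hϑU)
    ((nondegBeta_le_ckNormOn_thickening hKne hϑ hc).trans (le_iSup₂_of_le c hc le_rfl)))

theorem volume_normSq_pairing_le (hn : 2 ≤ n) (hU : IsOpen U)
    (hf : ContDiffOn ℝ (nondegIndex f K + 1 : ℕ) f U) (hK : IsCompact K) (hKnt : K.Nontrivial)
    (hϑ : 0 < ϑ) (hϑU : Metric.cthickening ϑ K ⊆ U)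
    (hf' : ContDiffOn ℝ (nondegIndex f K) f' (Metric.thickening ϑ K))
    (hclose : ckNormOn (Metric.thickening ϑ K) (nondegIndex f K) (fun y => f y - f' y) ≤
      ENNReal.ofReal (closenessBound f K ϑ))
    (hμ : 0 < nondegIndex f K) (hc : ‖c‖ = 1) {x : ℝ} (hx : 0 < x) :
    volume {y ∈ K | ‖pairing c (f' y)‖ ^ 2 ≤ x ^ nondegIndex f K * nondegAmount f K} ≤
      ENNReal.ofReal (constM f K ϑ * nondegAmount f K ^ (1 / (nondegIndex f K : ℝ)) * x) := by
  have hle : (nondegIndex f K : WithTop ℕ∞) ≤ (nondegIndex f K + 1 : ℕ) := by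
    exact_mod_cast Nat.le_succ _
  have hβ := nondegAmount_pos hU (hf.of_le hle) hK hKnt.nonempty hϑ hϑU hμ hc
  have hGtop := iSup_ckNormOn_pairSq_ne_top hU hf hK hϑU
  have hcG := le_iSup₂_of_le (f := fun (c : CSpace l) (_ : ‖c‖ = 1) =>
    ckNormOn (Metric.thickening ϑ K) (nondegIndex f K + 1) (pairSq c f)) c hc le_rfl
  have hβG := ((nondegBeta_le_ckNormOn_thickening hKnt.nonempty hϑ hc).trans
    (ckNormOn_le_of_le (Nat.le_succ _) _)).trans hcG
  have hG := (ckNormOn_le_ofReal_iff ENNReal.toReal_nonneg).1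
    (hcG.trans (ENNReal.ofReal_toReal hGtop).ge)
  rw [pairSq_eq] at hG
  have hfϑ := hf.mono ((Metric.thickening_subset_cthickening _ _).trans hϑU)
  obtain ⟨R, hR0, hR⟩ := exists_ckNormLE_thickening hU (hf.of_le hle) hK hϑU
  have hL : ‖pairing c‖ ≤ 1 := ((norm_pairing c).trans hc).le
  have hopen := Metric.isOpen_thickening (δ := ϑ) (E := K)
  have hF := (ckNormLE_toReal_ckNormOn (hR.ckNormOn_ne_top hR0)).clm_comp hL hopen (hfϑ.of_le hle)
  have hδ := ((ckNormOn_le_ofReal_iff (closenessBound_nonneg f K ϑ)).1 hclose).clm_comp hL hopen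
    ((hfϑ.of_le hle).sub hf')
  simp only [map_sub] at hδ
  refine (volume_normSq_le_le hn finrank_real_CSpace hK
    (Metric.diam_pos hKnt hK.isBounded) hϑ hμ ((pairing c).contDiff.comp_contDiffOn hfϑ)
    ((pairing c).contDiff.comp_contDiffOn hf') hF hδ hG hβ
    (closenessBound_mul_add f K ϑ).le (ENNReal.toReal_mono hGtop hβG)
    (fun y hy => exists_nondegAmount_le_abs_dirDeriv hμ hy hc) hx).trans_eq ?_
  have hpow : nondegAmount f K ^ (-1 / (nondegIndex f K : ℝ) - 1) *
      nondegAmount f K ^ (1 / (nondegIndex f K : ℝ)) = (nondegAmount f K)⁻¹ := by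
    rw [← Real.rpow_add hβ, ← Real.rpow_neg_one]
    ring_nf
  rw [constM, constB_eq, div_eq_mul_inv (ENNReal.toReal _), ← hpow]
  ring_nf

theorem rpow_two_div_mul_rpow_pow {μ : ℕ} (hμ : 0 < μ) {s β : ℝ} (hs : 0 ≤ s) (hβ : 0 < β) :
    (s ^ (2 / (μ : ℝ)) * β ^ (-1 / (μ : ℝ))) ^ μ * β = s ^ 2 := by
  have hμ' : (μ : ℝ) ≠ 0 := by exact_mod_cast hμ.ne'
  rw [mul_pow, ← Real.rpow_mul_natCast hs, ← Real.rpow_mul_natCast hβ.le, div_mul_cancel₀ _ hμ',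
    div_mul_cancel₀ _ hμ', Real.rpow_neg_one, mul_assoc, inv_mul_cancel₀ hβ.ne', mul_one,
    Real.rpow_two]

theorem volume_norm_pairing_lt_le_of_norm_eq_one (hn : 2 ≤ n) (hU : IsOpen U)
    (hf : ContDiffOn ℝ (nondegIndex f K + 1 : ℕ) f U) (hK : IsCompact K) (hKnt : K.Nontrivial)
    (hϑ : 0 < ϑ) (hϑU : Metric.cthickening ϑ K ⊆ U)
    (hf' : ContDiffOn ℝ (nondegIndex f K) f' (Metric.thickening ϑ K))
    (hclose : ckNormOn (Metric.thickening ϑ K) (nondegIndex f K) (fun y => f y - f' y) ≤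
      ENNReal.ofReal (closenessBound f K ϑ))
    (hμ : 0 < nondegIndex f K) (hc : ‖c‖ = 1) {s : ℝ} (hs : 0 < s) :
    volume {y ∈ K | ‖pairing c (f' y)‖ < s} ≤
      ENNReal.ofReal (constM f K ϑ * s ^ (2 / (nondegIndex f K : ℝ))) := by
  have hβ : 0 < nondegAmount f K := nondegAmount_pos hU
    (hf.of_le (by exact_mod_cast Nat.le_succ _)) hK hKnt.nonempty hϑ hϑU hμ hc
  have hpow := rpow_two_div_mul_rpow_pow hμ hs.le hβ
  have hvol := volume_normSq_pairing_le hn hU hf hK hKnt hϑ hϑU hf' hclose hμ hc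
    (x := s ^ (2 / (nondegIndex f K : ℝ)) * nondegAmount f K ^ (-1 / (nondegIndex f K : ℝ)))
    (by positivity)
  rw [hpow] at hvol
  have hsub : {y ∈ K | ‖pairing c (f' y)‖ < s} ⊆ {y ∈ K | ‖pairing c (f' y)‖ ^ 2 ≤ s ^ 2} :=
    fun y hy => ⟨hy.1, pow_le_pow_left₀ (norm_nonneg _) hy.2.le 2⟩
  have hinv : nondegAmount f K ^ (1 / (nondegIndex f K : ℝ)) *
      nondegAmount f K ^ (-1 / (nondegIndex f K : ℝ)) = 1 := by
    rw [← Real.rpow_add hβ, neg_div, add_neg_cancel, Real.rpow_zero]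
  refine (measure_mono hsub).trans (hvol.trans_eq (congrArg ENNReal.ofReal ?_))
  linear_combination constM f K ϑ * s ^ (2 / (nondegIndex f K : ℝ)) * hinv

theorem volume_norm_pairing_lt_le (hn : 2 ≤ n) (hU : IsOpen U)
    (hf : ContDiffOn ℝ (nondegIndex f K + 1 : ℕ) f U) (hK : IsCompact K) (hKnt : K.Nontrivial)
    (hϑ : 0 < ϑ) (hϑU : Metric.cthickening ϑ K ⊆ U)
    (hf' : ContDiffOn ℝ (nondegIndex f K) f' (Metric.thickening ϑ K))
    (hclose : ckNormOn (Metric.thickening ϑ K) (nondegIndex f K) (fun y => f y - f' y) ≤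
      ENNReal.ofReal (closenessBound f K ϑ))
    (hμ : 0 < nondegIndex f K) {w s : ℝ} (hw : 0 < w) (hwc : w ≤ ‖c‖) (hs : 0 < s) :
    volume {y ∈ K | ‖pairing c (f' y)‖ < s} ≤
      ENNReal.ofReal (constM f K ϑ * (s / w) ^ (2 / (nondegIndex f K : ℝ))) := by
  have hc : 0 < ‖c‖ := hw.trans_le hwc
  have hunit : ‖((‖c‖⁻¹ : ℝ) : ℂ) • c‖ = 1 := by
    rw [norm_smul, Complex.norm_real, norm_inv, norm_norm, inv_mul_cancel₀ hc.ne']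
  have hsub : {y ∈ K | ‖pairing c (f' y)‖ < s} ⊆
      {y ∈ K | ‖pairing (((‖c‖⁻¹ : ℝ) : ℂ) • c) (f' y)‖ < s / w} := by
    rintro y ⟨hy, hlt⟩
    refine ⟨hy, ?_⟩
    rw [norm_pairing_smul, abs_of_nonneg (by positivity), inv_mul_eq_div]
    exact (div_lt_div_of_pos_right hlt hc).trans_le (div_le_div_of_nonneg_left hs.le hw hwc)
  exact (measure_mono hsub).trans (volume_norm_pairing_lt_le_of_norm_eq_one hn hU hf hK hKnt hϑ
    hϑU hf' hclose hμ hunit (div_pos hs hw))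

end NondegenerateMeasure

/-! ### Weights -/

section Weights

variable {n l : ℕ} {𝔤 : Type*} [LieRing 𝔤] [LieAlgebra ℂ 𝔤] {g : Module.Basis (Fin l) ℂ 𝔤}
  {S : 𝔤 →ₗ⁅ℂ⁆ Matrix (Fin n) (Fin n) ℂ} {ω : ℕ → ℝ} {μ₀ k : ℕ}

theorem nonzeroWeights_eq_image_degreeBlock (S : 𝔤 →ₗ⁅ℂ⁆ Matrix (Fin n) (Fin n) ℂ) (k : ℕ) :
    nonzeroWeights S (2 ^ (k - 1) + 1) (2 ^ k) =
      (fun p : (Fin n → ℕ) × Fin n => weightForm S p.1 p.2) '' degreeBlock n k \ {0} := by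
  ext α
  constructor
  · rintro ⟨h0, Q, i, hlower, hupper, rfl⟩
    exact ⟨⟨(Q, i), mem_degreeBlock.2 ⟨hlower, hupper⟩, rfl⟩, h0⟩
  · rintro ⟨⟨⟨Q, i⟩, hp, rfl⟩, h0⟩
    exact ⟨h0, Q, i, (mem_degreeBlock.1 hp).1, (mem_degreeBlock.1 hp).2, rfl⟩

theorem finite_nonzeroWeights (S : 𝔤 →ₗ⁅ℂ⁆ Matrix (Fin n) (Fin n) ℂ) (k : ℕ) :
    (nonzeroWeights S (2 ^ (k - 1) + 1) (2 ^ k)).Finite := by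
  rw [nonzeroWeights_eq_image_degreeBlock]
  exact ((degreeBlock n k).finite_toSet.image _).sdiff

theorem ncard_nonzeroWeights_le (S : 𝔤 →ₗ⁅ℂ⁆ Matrix (Fin n) (Fin n) ℂ) (k : ℕ) :
    (nonzeroWeights S (2 ^ (k - 1) + 1) (2 ^ k)).ncard ≤ (degreeBlock n k).card := by
  have hfin := (degreeBlock n k).finite_toSet
  rw [nonzeroWeights_eq_image_degreeBlock]
  exact (Set.ncard_sdiff_singleton_le _ _).trans
    ((Set.ncard_image_le hfin).trans_eq (Set.ncard_coe_finset _))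

theorem dualMaxNorm_nonneg (g : Module.Basis (Fin l) ℂ 𝔤) (α : Module.Dual ℂ 𝔤) :
    0 ≤ dualMaxNorm g α :=
  Real.iSup_nonneg fun _ => norm_nonneg _

theorem dualMaxNorm_pos (g : Module.Basis (Fin l) ℂ 𝔤) {α : Module.Dual ℂ 𝔤} (hα : α ≠ 0) :
    0 < dualMaxNorm g α := by
  obtain ⟨j, hj⟩ : ∃ j, α (g j) ≠ 0 := by
    contrapose! hα
    exact g.ext hα
  exact (norm_pos_iff.2 hj).trans_le
    (le_ciSup (f := fun j => ‖α (g j)‖) (Set.finite_range _).bddAbove j)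

theorem dualMaxNorm_le_norm_toLp (g : Module.Basis (Fin l) ℂ 𝔤) (α : Module.Dual ℂ 𝔤) :
    dualMaxNorm g α ≤ ‖(WithLp.toLp 2 fun j => α (g j) : CSpace l)‖ :=
  Real.iSup_le (fun j => PiLp.norm_apply_le (WithLp.toLp 2 fun j => α (g j) : CSpace l) j)
    (norm_nonneg _)

theorem apply_sum_smul_basis (g : Module.Basis (Fin l) ℂ 𝔤) (α : Module.Dual ℂ 𝔤) (v : CSpace l) :
    α (∑ j, v j • g j) = pairing (WithLp.toLp 2 fun j => α (g j)) v := by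
  simp [pairing_apply, map_sum, mul_comm]

theorem omegaS_nonneg (g : Module.Basis (Fin l) ℂ 𝔤) (S : 𝔤 →ₗ⁅ℂ⁆ Matrix (Fin n) (Fin n) ℂ)
    (k : ℕ) : 0 ≤ omegaS g S k :=
  Real.sInf_nonneg (by rintro _ ⟨α, -, rfl⟩; exact dualMaxNorm_nonneg g α)

theorem omegaS_le_dualMaxNorm {α : Module.Dual ℂ 𝔤}
    (hα : α ∈ nonzeroWeights S (2 ^ (k - 1) + 1) (2 ^ k)) : omegaS g S k ≤ dualMaxNorm g α :=
  csInf_le ((finite_nonzeroWeights S k).image _).bddBelow ⟨α, hα, rfl⟩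

theorem omegaS_pos (hne : (nonzeroWeights S (2 ^ (k - 1) + 1) (2 ^ k)).Nonempty) :
    0 < omegaS g S k := by
  obtain ⟨α, hα, hmin⟩ :=
    (hne.image (dualMaxNorm g)).csInf_mem ((finite_nonzeroWeights S k).image (dualMaxNorm g))
  exact (dualMaxNorm_pos g hα.1).trans_eq hmin

theorem ratioPow_nonneg (h : 0 ≤ ω k) : 0 ≤ ratioPow g S ω μ₀ k :=
  Real.rpow_nonneg (div_nonneg h (omegaS_nonneg g S k)) _

/-- For `μ₀ = 0` the exponent `2 / μ₀` is the junk value `0`, and the weighted ratios are at least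
`1`. -/
theorem IsStrictlyDiophantine.index_pos (h : IsStrictlyDiophantine g S ω μ₀) : 0 < μ₀ := by
  refine Nat.pos_of_ne_zero ?_
  rintro rfl
  have hlim := h.tendsto_zero
  simp only [ratioPow, Nat.cast_zero, div_zero, Real.rpow_zero, mul_one] at hlim
  have hone (k : ℕ) : (1 : ℝ) ≤ ((2 : ℝ) ^ k + n + 1) ^ (n + 1) :=
    one_le_pow₀ (le_add_of_nonneg_left (by positivity))
  exact zero_lt_one.not_ge (ge_of_tendsto' hlim hone)

theorem IsStrictlyDiophantine.le_supWeightedRatio (h : IsStrictlyDiophantine g S ω μ₀)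
    (hk : 1 ≤ k) :
    ((2 : ℝ) ^ k + n + 1) ^ (n + 1) * ratioPow g S ω μ₀ k ≤ supWeightedRatio g S ω μ₀ := by
  obtain ⟨B, hB⟩ := h.tendsto_zero.bddAbove_range
  refine le_ciSup (f := fun k : {k : ℕ // 1 ≤ k} =>
    ((2 : ℝ) ^ (k : ℕ) + n + 1) ^ (n + 1) * ratioPow g S ω μ₀ k) ⟨B, ?_⟩ ⟨k, hk⟩
  rintro _ ⟨j, rfl⟩
  exact hB ⟨j, rfl⟩

theorem IsStrictlyDiophantine.sum_card_mul_ratioPow_le (h : IsStrictlyDiophantine g S ω μ₀)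
    (hn : 2 ≤ n) (N : ℕ) :
    ∑ k ∈ Finset.range N, ((degreeBlock n (k + 1)).card : ℝ) * ratioPow g S ω μ₀ (k + 1) ≤
      ((2 ^ 2 + (n : ℝ)) ^ n * ratioPow g S ω μ₀ 2 - ((n : ℝ) + 1) * ratioPow g S ω μ₀ 1 +
        (n : ℝ) / 4 * supWeightedRatio g S ω μ₀) / ((n - 1).factorial : ℝ) :=
  sum_card_degreeBlock_mul_le hn (fun k hk => ratioPow_nonneg (h.diophantine.pos k hk).le)
    (fun _ => h.le_supWeightedRatio) N

theorem IsStrictlyDiophantine.threshold_nonneg (h : IsStrictlyDiophantine g S ω μ₀) (hn : 2 ≤ n) :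
    0 ≤ (2 ^ 2 + (n : ℝ)) ^ n * ratioPow g S ω μ₀ 2 - ((n : ℝ) + 1) * ratioPow g S ω μ₀ 1 +
      (n : ℝ) / 4 * supWeightedRatio g S ω μ₀ := by
  have hsum := h.sum_card_mul_ratioPow_le hn 0
  rwa [Finset.range_zero, Finset.sum_empty, le_div_iff₀ (by positivity), zero_mul] at hsum

end Weights

/-! ### The excluded set -/

section ExcludedSet

theorem nontrivial_of_measureReal_pos {n : ℕ} (hn : n ≠ 0) {K : Set (CSpace n)}
    (hvol : 0 < volume.real K) : K.Nontrivial := by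
  have : NeZero n := ⟨hn⟩
  rw [← Set.not_subsingleton_iff]
  intro h
  rw [Measure.real, h.measure_zero, ENNReal.toReal_zero] at hvol
  exact hvol.false

theorem mul_rpow_two_div_mul_le {μ : ℕ} (hμ : 0 < μ) {γ M D C : ℝ} (hγ0 : 0 < γ) (hM : 0 ≤ M)
    (hD : 0 ≤ D) (hC : 0 ≤ C) (hγ : γ ≤ (C / (M * D)) ^ ((μ : ℝ) / 2)) :
    M * γ ^ (2 / (μ : ℝ)) * D ≤ C := by
  rcases (mul_nonneg hM hD).eq_or_lt with hMD | hMD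
  · linear_combination hC + γ ^ (2 / (μ : ℝ)) * hMD.symm
  have hle : γ ^ (2 / (μ : ℝ)) ≤ C / (M * D) := by
    have hμ' : (μ : ℝ) ≠ 0 := by exact_mod_cast hμ.ne'
    refine (Real.rpow_le_rpow hγ0.le hγ (by positivity)).trans_eq ?_
    rw [← Real.rpow_mul (by positivity), div_mul_div_cancel₀ two_ne_zero, div_self hμ',
      Real.rpow_one]
  rw [le_div_iff₀ hMD] at hle
  linarith

variable {n l : ℕ} {𝔤 : Type*} [LieRing 𝔤] [LieAlgebra ℂ 𝔤] {g : Module.Basis (Fin l) ℂ 𝔤}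
  {S : 𝔤 →ₗ⁅ℂ⁆ Matrix (Fin n) (Fin n) ℂ} {ω : ℕ → ℝ} {f f' : CSpace n → CSpace l}
  {U K : Set (CSpace n)} {ϑ γ : ℝ} {k : ℕ}

/-- The points of `K` where `f'` violates the `k`-th small divisor condition defining
`diophantineSet`. -/
def excludedSet (g : Module.Basis (Fin l) ℂ 𝔤) (S : 𝔤 →ₗ⁅ℂ⁆ Matrix (Fin n) (Fin n) ℂ)
    (ω : ℕ → ℝ) (K : Set (CSpace n)) (γ : ℝ) (f' : CSpace n → CSpace l) (k : ℕ) :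
    Set (CSpace n) :=
  ⋃ α ∈ nonzeroWeights S (2 ^ (k - 1) + 1) (2 ^ k), {b ∈ K | ‖α (∑ j, f' b j • g j)‖ < γ * ω k}

theorem sdiff_diophantineSet_subset (g : Module.Basis (Fin l) ℂ 𝔤)
    (S : 𝔤 →ₗ⁅ℂ⁆ Matrix (Fin n) (Fin n) ℂ) (ω : ℕ → ℝ) (K : Set (CSpace n)) (γ : ℝ)
    (f' : CSpace n → CSpace l) :
    K \ diophantineSet g S ω K γ f' ⊆ ⋃ k : ℕ, excludedSet g S ω K γ f' (k + 1) := by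
  rintro b ⟨hbK, hb⟩
  obtain ⟨k, hk, α, hα, hlt⟩ : ∃ k, 1 ≤ k ∧ ∃ α ∈ nonzeroWeights S (2 ^ (k - 1) + 1) (2 ^ k),
      ‖α (∑ j, f' b j • g j)‖ < γ * ω k := by
    by_contra! h
    exact hb ⟨hbK, h⟩
  rw [← Nat.sub_add_cancel hk] at hα hlt
  exact Set.mem_iUnion.2 ⟨k - 1, Set.mem_iUnion₂.2 ⟨α, hα, hbK, hlt⟩⟩

theorem volume_norm_weight_lt_le (hn : 2 ≤ n) (hU : IsOpen U)
    (hf : ContDiffOn ℝ (nondegIndex f K + 1 : ℕ) f U) (hK : IsCompact K) (hKnt : K.Nontrivial)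
    (hϑ : 0 < ϑ) (hϑU : Metric.cthickening ϑ K ⊆ U)
    (hf' : ContDiffOn ℝ (nondegIndex f K) f' (Metric.thickening ϑ K))
    (hclose : ckNormOn (Metric.thickening ϑ K) (nondegIndex f K) (fun y => f y - f' y) ≤
      ENNReal.ofReal (closenessBound f K ϑ))
    (hμ : 0 < nondegIndex f K) (hγ : 0 < γ) (hω : 0 < ω k) {α : Module.Dual ℂ 𝔤}
    (hα : α ∈ nonzeroWeights S (2 ^ (k - 1) + 1) (2 ^ k)) :
    volume {b ∈ K | ‖α (∑ j, f' b j • g j)‖ < γ * ω k} ≤ ENNReal.ofReal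
      (constM f K ϑ * γ ^ (2 / (nondegIndex f K : ℝ)) * ratioPow g S ω (nondegIndex f K) k) := by
  have hw : 0 < omegaS g S k := omegaS_pos ⟨α, hα⟩
  simp only [apply_sum_smul_basis]
  refine (volume_norm_pairing_lt_le hn hU hf hK hKnt hϑ hϑU hf' hclose hμ hw
    ((omegaS_le_dualMaxNorm hα).trans (dualMaxNorm_le_norm_toLp g α)) (mul_pos hγ hω)).trans_eq ?_
  rw [mul_div_assoc, Real.mul_rpow hγ.le (div_pos hω hw).le, ratioPow, mul_assoc]

theorem volume_excludedSet_le (hn : 2 ≤ n) (hU : IsOpen U)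
    (hf : ContDiffOn ℝ (nondegIndex f K + 1 : ℕ) f U) (hK : IsCompact K) (hKnt : K.Nontrivial)
    (hϑ : 0 < ϑ) (hϑU : Metric.cthickening ϑ K ⊆ U)
    (hf' : ContDiffOn ℝ (nondegIndex f K) f' (Metric.thickening ϑ K))
    (hclose : ckNormOn (Metric.thickening ϑ K) (nondegIndex f K) (fun y => f y - f' y) ≤
      ENNReal.ofReal (closenessBound f K ϑ))
    (hμ : 0 < nondegIndex f K) (hγ : 0 < γ) (hω : 0 < ω k) :
    volume (excludedSet g S ω K γ f' k) ≤ ENNReal.ofReal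
      (constM f K ϑ * γ ^ (2 / (nondegIndex f K : ℝ)) *
        ((degreeBlock n k).card * ratioPow g S ω (nondegIndex f K) k)) := by
  have hfin := finite_nonzeroWeights S k
  have hunion : excludedSet g S ω K γ f' k =
      ⋃ α ∈ hfin.toFinset, {b ∈ K | ‖α (∑ j, f' b j • g j)‖ < γ * ω k} := by
    simp only [excludedSet, Set.Finite.mem_toFinset]
  have hcard : hfin.toFinset.card ≤ (degreeBlock n k).card :=
    (Set.ncard_eq_toFinset_card _ hfin).symm.trans_le (ncard_nonzeroWeights_le S k)
  have hweight (α) (hα : α ∈ hfin.toFinset) := volume_norm_weight_lt_le (g := g) hn hU hf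
    hK hKnt hϑ hϑU hf' hclose hμ hγ hω (hfin.mem_toFinset.1 hα)
  rw [hunion]
  refine (measure_biUnion_finset_le _ _).trans ((Finset.sum_le_card_nsmul _ _ _ hweight).trans ?_)
  refine (nsmul_le_nsmul_left zero_le hcard).trans_eq ?_
  rw [← ENNReal.ofReal_nsmul, nsmul_eq_mul, mul_left_comm]

theorem volume_sdiff_diophantineSet_le (hn : 2 ≤ n) (hU : IsOpen U)
    (hf : ContDiffOn ℝ (nondegIndex f K + 1 : ℕ) f U) (hK : IsCompact K) (hKnt : K.Nontrivial)
    (hϑ : 0 < ϑ) (hϑU : Metric.cthickening ϑ K ⊆ U)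
    (hf' : ContDiffOn ℝ (nondegIndex f K) f' (Metric.thickening ϑ K))
    (hclose : ckNormOn (Metric.thickening ϑ K) (nondegIndex f K) (fun y => f y - f' y) ≤
      ENNReal.ofReal (closenessBound f K ϑ))
    (hS : IsStrictlyDiophantine g S ω (nondegIndex f K)) (hγ : 0 < γ) :
    volume (K \ diophantineSet g S ω K γ f') ≤ ENNReal.ofReal
      (constM f K ϑ * γ ^ (2 / (nondegIndex f K : ℝ)) *
        (((2 ^ 2 + (n : ℝ)) ^ n * ratioPow g S ω (nondegIndex f K) 2
          - ((n : ℝ) + 1) * ratioPow g S ω (nondegIndex f K) 1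
          + (n : ℝ) / 4 * supWeightedRatio g S ω (nondegIndex f K)) /
            ((n - 1).factorial : ℝ))) := by
  have hM := constM_nonneg f K hϑ
  have hω (k : ℕ) : 0 < ω (k + 1) := hS.diophantine.pos _ (Nat.le_add_left _ _)
  refine (measure_mono (sdiff_diophantineSet_subset g S ω K γ f')).trans
    ((measure_iUnion_le _).trans (ENNReal.tsum_le_of_sum_range_le fun N => ?_))
  calc ∑ k ∈ Finset.range N, volume (excludedSet g S ω K γ f' (k + 1))
      ≤ ∑ k ∈ Finset.range N, ENNReal.ofReal (constM f K ϑ * γ ^ (2 / (nondegIndex f K : ℝ)) *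
          ((degreeBlock n (k + 1)).card * ratioPow g S ω (nondegIndex f K) (k + 1))) :=
        Finset.sum_le_sum fun k _ => volume_excludedSet_le hn hU hf hK hKnt hϑ hϑU hf' hclose
          hS.index_pos hγ (hω k)
    _ = ENNReal.ofReal (constM f K ϑ * γ ^ (2 / (nondegIndex f K : ℝ)) *
          ∑ k ∈ Finset.range N,
            (degreeBlock n (k + 1)).card * ratioPow g S ω (nondegIndex f K) (k + 1)) := by
        rw [Finset.mul_sum, ENNReal.ofReal_sum_of_nonneg fun k _ => mul_nonneg (by positivity)
          (mul_nonneg (Nat.cast_nonneg _) (ratioPow_nonneg (hω k).le))]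
    _ ≤ _ := by
        gcongr
        exact hS.sum_card_mul_ratioPow_le hn N

end ExcludedSet

theorem mainTheorem3_general {n l : ℕ} (hn : 2 ≤ n)
    {𝔤 : Type*} [LieRing 𝔤] [LieAlgebra ℂ 𝔤]
    (g : Module.Basis (Fin l) ℂ 𝔤)
    (S : 𝔤 →ₗ⁅ℂ⁆ Matrix (Fin n) (Fin n) ℂ) (hSdiag : ∀ x, (S x).IsDiag)
    (U : Set (CSpace n)) (hUo : IsOpen U)
    (f : CSpace n → CSpace l) (K : Set (CSpace n))
    (hf : ContDiffOn ℝ (nondegIndex f K + 1 : ℕ) f U) (hKc : IsCompact K)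
    (ω : ℕ → ℝ) (hS : IsStrictlyDiophantine g S ω (nondegIndex f K))
    (ϑ : ℝ) (hϑ0 : 0 < ϑ) (hϑ : ENNReal.ofReal ϑ < ⨅ x ∈ K, Metric.infEDist x Uᶜ)
    (f' : CSpace n → CSpace l)
    (hf' : ContDiffOn ℝ (nondegIndex f K) f' (Metric.thickening ϑ K))
    (hclose : ckNormOn (Metric.thickening ϑ K) (nondegIndex f K) (fun y => f y - f' y) ≤
      ENNReal.ofReal (closenessBound f K ϑ))
    (ε : ℝ) (hε0 : 0 < ε)
    (γ : ℝ) (hγ0 : 0 < γ)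
    (hγ : γ ≤ (ε * ((n - 1).factorial : ℝ) /
        (constM f K ϑ *
          ((2 ^ 2 + (n : ℝ)) ^ n * ratioPow g S ω (nondegIndex f K) 2
            - ((n : ℝ) + 1) * ratioPow g S ω (nondegIndex f K) 1
            + (n : ℝ) / 4 * supWeightedRatio g S ω (nondegIndex f K)))) ^
      ((nondegIndex f K : ℝ) / 2)) :
    volume.real K - ε ≤ volume.real (diophantineSet g S ω K γ f') := by
  obtain hε | hε := le_or_gt (volume.real K) ε
  · exact (sub_nonpos.2 hε).trans measureReal_nonneg
  have hKnt := nontrivial_of_measureReal_pos (by omega) (hε0.trans hε)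
  have hfac : (0 : ℝ) < (n - 1).factorial := by positivity
  have hexcl := volume_sdiff_diophantineSet_le hn hUo hf hKc hKnt hϑ0
    (cthickening_subset_of_lt_iInf hϑ) hf' hclose hS hγ0
  have hthreshold := hS.threshold_nonneg hn
  have hγD := mul_rpow_two_div_mul_le hS.index_pos hγ0 (constM_nonneg f K hϑ0) hthreshold
    (by positivity) hγ
  have hε' : volume.real (K \ diophantineSet g S ω K γ f') ≤ ε := by
    refine ENNReal.toReal_le_of_le_ofReal hε0.le (hexcl.trans (ENNReal.ofReal_le_ofReal ?_))
    rwa [← mul_div_assoc, div_le_iff₀ hfac]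
  have hfin : volume (diophantineSet g S ω K γ f') ≠ ⊤ :=
    measure_ne_top_of_subset (Set.sep_subset K _) hKc.measure_ne_top
  have hdiff : volume.real K - volume.real (diophantineSet g S ω K γ f') ≤
      volume.real (K \ diophantineSet g S ω K γ f') :=
    le_measureReal_sdiff hfin
  linarith

theorem mainTheorem3 {n l : ℕ} (hn : 2 ≤ n) (hl : 1 ≤ l)
    {𝔤 : Type*} [LieRing 𝔤] [LieAlgebra ℂ 𝔤] [IsLieAbelian 𝔤]
    (g : Module.Basis (Fin l) ℂ 𝔤)
    (S : 𝔤 →ₗ⁅ℂ⁆ Matrix (Fin n) (Fin n) ℂ)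
    (hSinj : Function.Injective S) (hSdiag : ∀ x, (S x).IsDiag)
    (U : Set (CSpace n)) (hUo : IsOpen U) (hUc : IsConnected U) (h0U : (0 : CSpace n) ∈ U)
    (f : CSpace n → CSpace l) (hf : DifferentiableOn ℂ f U) (hfnd : IsNondegenerateOn U f)
    (K : Set (CSpace n)) (hKc : IsCompact K) (hKne : K.Nonempty) (hKU : K ⊆ U)
    (ω : ℕ → ℝ) (hS : IsStrictlyDiophantine g S ω (nondegIndex f K))
    (ϑ : ℝ) (hϑ0 : 0 < ϑ) (hϑ : ENNReal.ofReal ϑ < ⨅ x ∈ K, Metric.infEDist x Uᶜ)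
    (f' : CSpace n → CSpace l)
    (hf' : ContDiffOn ℝ (nondegIndex f K) f' (Metric.thickening ϑ K))
    (hclose : ckNormOn (Metric.thickening ϑ K) (nondegIndex f K) (fun y => f y - f' y) ≤
      ENNReal.ofReal (closenessBound f K ϑ))
    (ε : ℝ) (hε0 : 0 < ε) (hε : ε < volume.real K)
    (γ : ℝ) (hγ0 : 0 < γ) (hγ : γ ≤ gammaStar g S ω f K ϑ ε) :
    volume.real K - ε ≤ volume.real (diophantineSet g S ω K γ f') :=
  mainTheorem3_general hn g S hSdiag U hUo f K
    ((contDiffOn_of_differentiableOn_complex hUo hf _).restrict_scalars ℝ) hKc ω hS ϑ hϑ0 hϑ f' hf'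
    hclose ε hε0 γ hγ0 (hγ.trans (min_le_left _ _))
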